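/- Let $G$ and $T$ be finitely presented groups. All (co)homology of groups is the (unreduced) (co)homology of discrete groups with coefficients in the field $\mathbb{F}_2$ with two elements. Suppose that $G$ satisfies property (A): for every non-zero $\alpha\in H^1(G;\mathbb{F}_2)$ there is $\beta\in H^1(G;\mathbb{F}_2)$ with $\alpha\cup\beta\neq 0$ in $H^2(G;\mathbb{F}_2)$. Let $$\chi_{\leq 2}(G):=\dim H_2(G;\mathbb{F}_2)-\dim H_1(G;\mathbb{F}_2)+\dim H_0(G;\mathbb{F}_2)$$ be the $2$-truncated Euler characteristic of $G$, and, for an integer $k\leq 2$, let $$\rho(k):=\left\lceil\frac{7+\sqrt{49-24k}}{2}\right\rceil .$$ For a finitely presented group $\Gamma$, let the simplicial complexity $\kappa(\Gamma)$ be the minimum number of $2$-simplices of a finite connected simplicial complex of dimension $2$ (that is, with at least one $2$-simplex and no simplices of higher dimension) whose fundamental group is isomorphic to $\Gamma$. If $\chi_{\leq 2}(G)\leq 2$ and $H_2(G;\mathbb{F}_2)\neq 0$, then the free product $G*T$ satisfies $$\kappa(G*T)\;\geq\; 2\rho(\chi_{\leq 2}(G))-2\chi_{\leq 2}(G).$$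 -/

import Mathlib

universe u v

/-! ### The field with two elements and the (co)homology of a discrete group -/

/-- The field `𝔽₂` with two elements, as a type in an arbitrary universe. -/
def F2 : Type u := ULift.{u} (ZMod 2)

noncomputable instance F2.instField : Field F2.{u} :=
  inferInstanceAs (Field (ULift.{u} (ZMod 2)))

/-- The trivial representation of `G` on `𝔽₂`. -/
noncomputable abbrev trivF2 (G : Type u) [Group G] : Rep F2.{u} G :=
  Rep.trivial F2.{u} G F2.{u}

/-- The homology `Hₙ(G; 𝔽₂)` of the discrete group `G`. -/
noncomputable abbrev homologyF2 (G : Type u) [Group G] (n : ℕ) : ModuleCat F2.{u} :=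
  groupHomology (trivF2 G) n

/-- The cohomology `Hⁿ(G; 𝔽₂)` of the discrete group `G`. -/
noncomputable abbrev cohomologyF2 (G : Type u) [Group G] (n : ℕ) : ModuleCat F2.{u} :=
  groupCohomology (trivF2 G) n

/-- A class in `H¹(G; 𝔽₂)` seen as a homomorphism `G → 𝔽₂`, that is, as the unique inhomogeneous
`1`-cocycle representing it (all `1`-coboundaries vanish, the coefficients being trivial). -/
noncomputable def classHom {G : Type u} [Group G] :
    cohomologyF2 G 1 →ₗ[F2.{u}] (Additive G →+ F2.{u}) :=
  (groupCohomology.H1IsoOfIsTrivial (trivF2 G)).hom.hom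

/-- The cup product of two `1`-cocycles, on the level of inhomogeneous cochains:
`(a ∪ b)(g, h) = a(g) b(h)`. -/
noncomputable def cupCocycle {G : Type u} [Group G] (a b : Additive G →+ F2.{u}) :
    groupCohomology.cocycles₂ (trivF2 G) :=
  ⟨fun g => a (Additive.ofMul g.1) * b (Additive.ofMul g.2), by
    rw [groupCohomology.mem_cocycles₂_iff]
    intro g h j
    simp only [ofMul_mul, map_add, Representation.trivial_apply]
    ring⟩

/-- The cup product `H¹(G; 𝔽₂) × H¹(G; 𝔽₂) → H²(G; 𝔽₂)`. -/
noncomputable def cupProduct {G : Type u} [Group G] :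
    cohomologyF2 G 1 →ₗ[F2.{u}] cohomologyF2 G 1 →ₗ[F2.{u}] cohomologyF2 G 2 :=
  LinearMap.mk₂ F2.{u}
    (fun α β => (groupCohomology.H2π (trivF2 G)).hom (cupCocycle (classHom α) (classHom β)))
    (fun α α' β => by
      rw [← map_add, map_add]
      exact congrArg _ (Subtype.ext (funext fun g => add_mul _ _ _)))
    (fun c α β => by
      rw [← map_smul, map_smul]
      exact congrArg _ (Subtype.ext (funext fun g => mul_assoc _ _ _)))
    (fun α β β' => by
      rw [← map_add, map_add]
      exact congrArg _ (Subtype.ext (funext fun g => mul_add _ _ _)))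
    (fun c α β => by
      rw [← map_smul, map_smul]
      exact congrArg _ (Subtype.ext (funext fun g => mul_left_comm _ _ _)))

/-- Property (A): every non-trivial class in `H¹(G; 𝔽₂)` has a non-trivial cup product with some
class in `H¹(G; 𝔽₂)`. -/
def PropertyA (G : Type u) [Group G] : Prop :=
  ∀ α : cohomologyF2 G 1, α ≠ 0 → ∃ β : cohomologyF2 G 1, cupProduct α β ≠ 0

/-- The `2`-truncated Euler characteristic
`χ_{≤2}(G) = dim H₂(G; 𝔽₂) - dim H₁(G; 𝔽₂) + dim H₀(G; 𝔽₂)` (the dimensions are finite when `G` is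
finitely presented). -/
noncomputable def truncEuler (G : Type u) [Group G] : ℤ :=
  (Module.finrank F2.{u} (homologyF2 G 2) : ℤ) - Module.finrank F2.{u} (homologyF2 G 1)
    + Module.finrank F2.{u} (homologyF2 G 0)

/-- `ρ(k) = ⌈(7 + √(49 - 24k)) / 2⌉`, meant for integers `k ≤ 2`. -/
noncomputable def rho (k : ℤ) : ℤ := ⌈(7 + Real.sqrt (49 - 24 * (k : ℝ))) / 2⌉

/-! ### Finite simplicial complexes and simplicial complexity -/

/-- The geometric realization of a simplicial complex `K` with vertices `0, …, n - 1`: the union,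
over the faces `s` of `K`, of the faces of the standard simplex in `ℝⁿ` spanned by the basis vectors
with index in `s`. -/
def realization {n : ℕ} (K : AbstractSimplicialComplex (Fin n)) : Set (Fin n → ℝ) :=
  {x | x ∈ stdSimplex ℝ (Fin n) ∧ ∃ s ∈ K.faces, ∀ i, i ∉ s → x i = 0}

/-- `K` has dimension `2`: all simplices have at most three vertices, and there is at least one
`2`-simplex. -/
def IsTwoDimensional {n : ℕ} (K : AbstractSimplicialComplex (Fin n)) : Prop :=
  (∀ s ∈ K.faces, s.card ≤ 3) ∧ ∃ s ∈ K.faces, s.card = 3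

/-- The number of `2`-simplices of `K`. -/
noncomputable def numTriangles {n : ℕ} (K : AbstractSimplicialComplex (Fin n)) : ℕ :=
  {s ∈ K.faces | s.card = 3}.ncard

/-- `K` is connected and its fundamental group is isomorphic to `G`. -/
def HasFundamentalGroup {n : ℕ} (K : AbstractSimplicialComplex (Fin n)) (G : Type u) [Group G] :
    Prop :=
  PathConnectedSpace (realization K) ∧
    ∃ x : realization K, Nonempty (FundamentalGroup (realization K) x ≃* G)

/-- The simplicial complexity `κ(G)`: the minimum number of `2`-simplices of a finite connected
simplicial complex of dimension `2` with fundamental group isomorphic to `G`. The value is `⊤` if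
there is no such complex, that is, if `G` is not finitely presentable. -/
noncomputable def simplicialComplexity (G : Type u) [Group G] : ℕ∞ :=
  sInf {m : ℕ∞ | ∃ (n : ℕ) (K : AbstractSimplicialComplex (Fin n)),
    IsTwoDimensional K ∧ HasFundamentalGroup K G ∧ m = numTriangles K}

/-! Let `K` be a complex with fundamental group `G * T`. Then `G` is a retract of `π₁(K)`. If a
2-cocycle of `G` pulls back to a coboundary on `K`, a cochain bounding it lifts `π₁(K) → G` to the
corresponding extension of `G`; composing with `G → π₁(K)` splits the extension, so the cocycle is a
coboundary (`detects_triangles`). Hence `H²(G)` embeds in `H²(K)`.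

Take a minimal set `S` of triangles on which `H²(G)` still injects. Minimality puts every edge of
`S` in two triangles (`exists_other_triangle`) and makes `H²(G) → H²(S)` an isomorphism
(`restrictClass_surjective`). By property (A), `H¹(G) → H¹(S)` is injective: if `α` dies on `S`, so
does every `α ∪ β`, which then vanishes in `H²(G)`.

The rest is Heawood's count (`rho_le_card_of_detects`). Let `M` and `N` be the numbers of triangles
and edges of `S`, and `m` one more than the rank of the coboundary on vertices (the number of
vertices, if `S` is connected). Then `m - N + M ≤ χ`, `2N ≤ 3M` and `2N ≤ m(m - 1)`. The first two
give `N ≥ 3(m - χ)`; with the third, `m² - 7m + 6χ ≥ 0`, so `m ≥ ρ(χ)` and `M ≥ 2(m - χ) ≥ 2ρ(χ) -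
2χ`.

Topology enters only through `exists_isEdgeCocycle_splitsLifts`: the open vertex stars form a good
cover with nerve `K`, which turns `π₁(K) → G` into a `G`-valued cocycle on edges. -/

/-! ### Cochains of a set of triangles -/

section Cochains

variable {V : Type*} [DecidableEq V] {F : Type*} [Field F]

/-- The edges of the triangles in `S`. -/
def edgesOf (S : Finset (Finset V)) : Finset (Finset V) := S.biUnion (Finset.powersetCard 2)

/-- The coboundary of a `0`-cochain with coefficients of characteristic two, restricted to a set of
edges. -/
def coboundary₀ (F : Type*) [Field F] (E : Finset (Finset V)) : (V → F) →ₗ[F] (E → F) where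
  toFun f e := ∑ v ∈ (e : Finset V), f v
  map_add' f g := by ext; simp [Finset.sum_add_distrib]
  map_smul' c f := by ext; simp [Finset.mul_sum]

/-- The coboundary of a `1`-cochain on a set of edges with coefficients of characteristic two,
restricted to a set of triangles. -/
def coboundary₁ (F : Type*) [Field F] (E S : Finset (Finset V)) : (E → F) →ₗ[F] (S → F) where
  toFun x t := ∑ e ∈ Finset.powersetCard 2 (t : Finset V), if h : e ∈ E then x ⟨e, h⟩ else 0
  map_add' f g := by
    ext t
    simp only [Pi.add_apply, ← Finset.sum_add_distrib]
    refine Finset.sum_congr rfl fun e _ => ?_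
    split_ifs <;> simp
  map_smul' c f := by
    ext t
    simp only [Pi.smul_apply, smul_eq_mul, Finset.mul_sum, RingHom.id_apply]
    refine Finset.sum_congr rfl fun e _ => ?_
    split_ifs <;> simp

lemma coboundary₁_restrict (S : Finset (Finset V)) (b : Finset V → F) (t : S) :
    coboundary₁ F (edgesOf S) S (fun e => b e) t =
      ∑ e ∈ Finset.powersetCard 2 (t : Finset V), b e := by
  refine Finset.sum_congr rfl fun e he => ?_
  have h : e ∈ edgesOf S := Finset.mem_biUnion.2 ⟨t, t.2, he⟩
  exact dif_pos h

lemma card_of_mem_edgesOf {S : Finset (Finset V)} {e : Finset V} (he : e ∈ edgesOf S) :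
    e.card = 2 := by
  obtain ⟨t, -, h⟩ := Finset.mem_biUnion.1 he
  exact (Finset.mem_powersetCard.1 h).2

/-- The coboundary of the indicator function of `v` is non-zero on `E` but vanishes on the edges
avoiding `v`, so restriction to those edges has a kernel. -/
lemma finrank_coboundary₀_avoiding_lt {E : Finset (Finset V)} {v : V}
    (hv : ∃ e ∈ E, v ∈ e) :
    Module.finrank F (LinearMap.range (coboundary₀ F (E.filter (v ∉ ·)))) + 1 ≤
      Module.finrank F (LinearMap.range (coboundary₀ F E)) := by
  obtain ⟨e, heE, hve⟩ := hv
  let res : (E → F) →ₗ[F] ((E.filter (v ∉ ·) : Finset _) → F) :=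
    LinearMap.funLeft F F fun e => ⟨e.1, (Finset.mem_filter.1 e.2).1⟩
  let ρ := res.domRestrict (LinearMap.range (coboundary₀ F E))
  have hρ : LinearMap.range ρ = LinearMap.range (coboundary₀ F (E.filter (v ∉ ·))) := by
    ext x
    constructor
    · rintro ⟨⟨_, f, rfl⟩, rfl⟩
      exact ⟨f, rfl⟩
    · rintro ⟨f, rfl⟩
      exact ⟨⟨_, f, rfl⟩, rfl⟩
  have hsum (e' : Finset V) : ∑ w ∈ e', (Pi.single v 1 : V → F) w = if v ∈ e' then 1 else 0 := by
    simp [Pi.single_apply]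
  have hker : 0 < Module.finrank F (LinearMap.ker ρ) := by
    have hmem : (⟨coboundary₀ F E (Pi.single v 1), LinearMap.mem_range_self (coboundary₀ F E) _⟩ :
        LinearMap.range (coboundary₀ F E)) ∈ LinearMap.ker ρ := by
      rw [LinearMap.mem_ker]
      ext e'
      change ∑ w ∈ e'.1, (Pi.single v 1 : V → F) w = 0
      rw [hsum, if_neg (Finset.mem_filter.1 e'.2).2]
    refine (Module.finrank_pos_iff_exists_ne_zero (R := F)).2
      ⟨(⟨_, hmem⟩ : LinearMap.ker ρ), fun h => ?_⟩
    have h0 := congrFun (congrArg Subtype.val (congrArg Subtype.val h)) ⟨e, heE⟩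
    change ∑ w ∈ e, (Pi.single v 1 : V → F) w = 0 at h0
    rw [hsum, if_pos hve] at h0
    exact one_ne_zero h0
  have := LinearMap.finrank_range_add_finrank_ker ρ
  rw [hρ] at this
  omega

lemma card_star_le_finrank {E : Finset (Finset V)} (hE : ∀ e ∈ E, e.card = 2) (v : V) :
    (E.filter (v ∈ ·)).card ≤ Module.finrank F (LinearMap.range (coboundary₀ F E)) := by
  let res : (E → F) →ₗ[F] ((E.filter (v ∈ ·) : Finset _) → F) :=
    LinearMap.funLeft F F fun e => ⟨e.1, (Finset.mem_filter.1 e.2).1⟩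
  have hsurj : Function.Surjective (res.domRestrict (LinearMap.range (coboundary₀ F E))) := by
    intro x
    -- The far endpoints of the edges at `v` are distinct, so with `f v = 0` the values there can be
    -- prescribed freely.
    let f : V → F := fun w => if h : w ≠ v ∧ {v, w} ∈ E.filter (v ∈ ·) then x ⟨_, h.2⟩ else 0
    refine ⟨⟨_, f, rfl⟩, ?_⟩
    ext ⟨e, he⟩
    change ∑ w ∈ e, f w = x ⟨e, he⟩
    obtain ⟨heE, hve⟩ := Finset.mem_filter.1 he
    obtain ⟨w, hw⟩ : ∃ w, e.erase v = {w} := by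
      rw [← Finset.card_eq_one, Finset.card_erase_of_mem hve, hE e heE]
    have hwv : w ≠ v := Finset.ne_of_mem_erase (hw ▸ Finset.mem_singleton_self w)
    obtain rfl : {v, w} = e := by rw [← Finset.insert_erase hve, hw]
    rw [Finset.sum_pair hwv.symm]
    simp only [f]
    rw [dif_neg (by simp), dif_pos ⟨hwv, he⟩, zero_add]
  have := LinearMap.finrank_le_finrank_of_surjective hsurj
  simpa using this

/-- A graph whose coboundary has rank `r` has at most `r (r + 1) / 2` edges. -/
lemma two_mul_card_edges_le (E : Finset (Finset V)) (hE : ∀ e ∈ E, e.card = 2) :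
    2 * E.card ≤ Module.finrank F (LinearMap.range (coboundary₀ F E)) *
      (Module.finrank F (LinearMap.range (coboundary₀ F E)) + 1) := by
  induction E using Finset.strongInduction with
  | H E ih =>
    obtain rfl | ⟨e, he⟩ := E.eq_empty_or_nonempty
    · simp
    obtain ⟨v, hv⟩ : e.Nonempty := Finset.card_pos.1 (by rw [hE e he]; norm_num)
    have hlt : E.filter (v ∉ ·) ⊂ E := Finset.filter_ssubset.2 ⟨e, he, by simpa using hv⟩
    have h1 := ih _ hlt fun e' he' => hE e' (hlt.1 he')
    have h2 := finrank_coboundary₀_avoiding_lt (F := F) ⟨e, he, hv⟩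
    have h3 := card_star_le_finrank (F := F) hE v
    have h4 := Finset.card_filter_add_card_filter_not (s := E) (v ∈ ·)
    generalize Module.finrank F (LinearMap.range (coboundary₀ F E)) = r at *
    generalize Module.finrank F (LinearMap.range (coboundary₀ F (E.filter (v ∉ ·)))) = r' at *
    -- With `r' ≤ r - 1`, the count is `r'(r' + 1) + 2r ≤ (r - 1)r + 2r = r(r + 1)`.
    nlinarith

lemma two_mul_card_edgesOf_le {S : Finset (Finset V)} (hS : ∀ t ∈ S, t.card = 3)
    (hdeg : ∀ e ∈ edgesOf S, ∀ t ∈ S, e ⊆ t → ∃ t' ∈ S, t' ≠ t ∧ e ⊆ t') :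
    2 * (edgesOf S).card ≤ 3 * S.card := by
  have := Finset.card_mul_le_card_mul (s := edgesOf S) (t := S) (m := 2) (n := 3) (· ⊆ ·)
    (fun e he => by
      obtain ⟨t, ht, het⟩ := Finset.mem_biUnion.1 he
      obtain ⟨t', ht', hne, het'⟩ := hdeg e he t ht (Finset.mem_powersetCard.1 het).1
      rw [Nat.succ_le_iff, Finset.one_lt_card]
      exact ⟨t', Finset.mem_filter.2 ⟨ht', het'⟩, t,
        Finset.mem_filter.2 ⟨ht, (Finset.mem_powersetCard.1 het).1⟩, hne⟩)
    (fun t ht => by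
      have hsub : (edgesOf S).bipartiteBelow (· ⊆ ·) t ⊆ Finset.powersetCard 2 t := fun e he => by
        obtain ⟨h1, h2⟩ := Finset.mem_filter.1 he
        exact Finset.mem_powersetCard.2 ⟨h2, card_of_mem_edgesOf h1⟩
      refine (Finset.card_le_card hsub).trans ?_
      rw [Finset.card_powersetCard, hS t ht]
      decide)
  omega

/-- Besides its own three edges, a triangle forces a neighbouring triangle, which has a vertex `x`
outside the first one and hence a further edge through `x`. -/
lemma four_le_card_edgesOf {S : Finset (Finset V)} (hS : ∀ t ∈ S, t.card = 3)
    (hdeg : ∀ e ∈ edgesOf S, ∀ t ∈ S, e ⊆ t → ∃ t' ∈ S, t' ≠ t ∧ e ⊆ t') (hne : S.Nonempty) :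
    4 ≤ (edgesOf S).card := by
  obtain ⟨t, ht⟩ := hne
  have hcard : (Finset.powersetCard 2 t).card = 3 := by
    rw [Finset.card_powersetCard, hS t ht]; decide
  obtain ⟨e, he⟩ : (Finset.powersetCard 2 t).Nonempty := Finset.card_pos.1 (by omega)
  have het := (Finset.mem_powersetCard.1 he).1
  obtain ⟨t', ht', hne, -⟩ := hdeg e (Finset.mem_biUnion.2 ⟨t, ht, he⟩) t ht het
  obtain ⟨x, hx', hx⟩ : ∃ x ∈ t', x ∉ t := by
    by_contra! h
    exact hne (Finset.eq_of_subset_of_card_le h (by rw [hS t ht, hS t' ht']))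
  obtain ⟨y, hy⟩ : (t'.erase x).Nonempty :=
    Finset.card_pos.1 (by rw [Finset.card_erase_of_mem hx', hS t' ht']; norm_num)
  obtain ⟨hyx, hy'⟩ := Finset.mem_erase.1 hy
  have hxy : {x, y} ∈ edgesOf S := Finset.mem_biUnion.2 ⟨t', ht', Finset.mem_powersetCard.2
    ⟨Finset.insert_subset hx' (Finset.singleton_subset_iff.2 hy'), Finset.card_pair hyx.symm⟩⟩
  have hxyt : {x, y} ∉ Finset.powersetCard 2 t := fun h =>
    hx ((Finset.mem_powersetCard.1 h).1 (Finset.mem_insert_self x _))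
  have : insert {x, y} (Finset.powersetCard 2 t) ⊆ edgesOf S := by
    refine Finset.insert_subset hxy fun e' he' => Finset.mem_biUnion.2 ⟨t, ht, he'⟩
  have := Finset.card_le_card this
  rw [Finset.card_insert_of_notMem hxyt] at this
  omega

lemma coboundary₁_comp_coboundary₀ [CharP F 2] {S : Finset (Finset V)}
    (hS : ∀ t ∈ S, t.card = 3) (f : V → F) :
    coboundary₁ F (edgesOf S) S (coboundary₀ F (edgesOf S) f) = 0 := by
  ext t
  refine (coboundary₁_restrict S (fun e => ∑ v ∈ e, f v) t).trans ?_
  obtain ⟨a, b, c, hab, hac, hbc, habc⟩ := Finset.card_eq_three.1 (hS t t.2)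
  have h := Finset.sum_comm' (s := Finset.powersetCard 2 (t : Finset V)) (t := fun e => e)
    (t' := (t : Finset V)) (s' := fun v => (Finset.powersetCard 2 (t : Finset V)).filter (v ∈ ·))
    (f := fun _ v => f v) (fun e v => by
      simp only [Finset.mem_filter, Finset.mem_powersetCard]
      exact ⟨fun h => ⟨h, h.1.1 h.2⟩, fun h => h.1⟩)
  rw [h]
  refine Finset.sum_eq_zero fun v hv => ?_
  rw [Finset.sum_const]
  have : ((Finset.powersetCard 2 (t : Finset V)).filter (v ∈ ·)).card = 2 := by
    have h3 : (Finset.powersetCard 2 (t : Finset V)).filter (v ∈ ·) =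
        ((t : Finset V).erase v).image fun w => {v, w} := by
      ext e
      simp only [Finset.mem_filter, Finset.mem_powersetCard, Finset.mem_image, Finset.mem_erase]
      constructor
      · rintro ⟨⟨het, he⟩, hve⟩
        obtain ⟨w, hw⟩ : ∃ w, e.erase v = {w} := by
          rw [← Finset.card_eq_one, Finset.card_erase_of_mem hve, he]
        have hwe : w ∈ e.erase v := hw ▸ Finset.mem_singleton_self w
        exact ⟨w, ⟨Finset.ne_of_mem_erase hwe, het (Finset.mem_of_mem_erase hwe)⟩,
          by rw [← hw, Finset.insert_erase hve]⟩
      · rintro ⟨w, ⟨hwv, hwt⟩, rfl⟩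
        exact ⟨⟨Finset.insert_subset hv (Finset.singleton_subset_iff.2 hwt),
          Finset.card_pair hwv.symm⟩, Finset.mem_insert_self _ _⟩
    rw [h3, Finset.card_image_of_injOn, Finset.card_erase_of_mem hv, hS t t.2]
    intro x hx y hy hxy
    have hx' : x ≠ v := (Finset.mem_erase.1 hx).1
    have : x ∈ ({v, y} : Finset V) := by
      rw [← show ({v, x} : Finset V) = {v, y} from hxy]
      simp
    simpa [hx'] using this
  rw [this, two_nsmul]
  exact CharTwo.add_self_eq_zero _

end Cochains

/-! ### Minimal sets of triangles detecting classes of degree two. -/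

section Detecting

variable {V : Type*} [DecidableEq V] {F : Type*} [Field F] {Z : Type*} [AddCommGroup Z] [Module F Z]

/-- A set `S` of triangles detects the classes of `Z` modulo `B` through the cochain map `Φ` if no
element of `Z` outside of `B` becomes a coboundary on `S`. -/
def Detects (Φ : Z →ₗ[F] (Finset V → F)) (B : Submodule F Z) (S : Finset (Finset V)) : Prop :=
  ∀ z, (∃ b : Finset V → F, ∀ t ∈ S, Φ z t = ∑ e ∈ Finset.powersetCard 2 t, b e) → z ∈ B

variable {Φ : Z →ₗ[F] (Finset V → F)} {B : Submodule F Z}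

lemma exists_minimal_detects {T : Finset (Finset V)} (hT : Detects Φ B T) :
    ∃ S ⊆ T, Detects Φ B S ∧ ∀ t ∈ S, ¬ Detects Φ B (S.erase t) := by
  obtain ⟨S, hST, hS⟩ := exists_minimal_le_of_wellFoundedLT (Detects Φ B) T hT
  refine ⟨S, hST, hS.prop, fun t ht h => ?_⟩
  exact (Finset.erase_ssubset ht).not_ge (hS.le_of_le h (Finset.erase_subset t S))

variable {S : Finset (Finset V)} (hS : Detects Φ B S) (hmin : ∀ t ∈ S, ¬ Detects Φ B (S.erase t))

-- An elementary collapse: if `t` were the only triangle on `e`, changing a cochain at `e` would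
-- correct its coboundary at `t` and nowhere else, so `t` could be dropped.
include hS hmin in
lemma exists_other_triangle (e : Finset V) (he : e ∈ edgesOf S) (t : Finset V) (ht : t ∈ S)
    (het : e ⊆ t) : ∃ t' ∈ S, t' ≠ t ∧ e ⊆ t' := by
  by_contra! h
  refine hmin t ht fun z ⟨b, hb⟩ => hS z ?_
  have he2 : e ∈ Finset.powersetCard 2 t := Finset.mem_powersetCard.2 ⟨het, card_of_mem_edgesOf he⟩
  refine ⟨Function.update b e (Φ z t - ∑ e' ∈ (Finset.powersetCard 2 t).erase e, b e'),
    fun t' ht' => ?_⟩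
  obtain rfl | hne := eq_or_ne t' t
  · rw [← Finset.add_sum_erase _ _ he2, Function.update_self,
      Finset.sum_congr rfl fun e' he' => Function.update_of_ne (Finset.ne_of_mem_erase he') _ _]
    ring
  · rw [hb t' (Finset.mem_erase.2 ⟨hne, ht'⟩)]
    refine Finset.sum_congr rfl fun e' he' => (Function.update_of_ne ?_ _ _).symm
    rintro rfl
    exact h t' ht' hne (Finset.mem_powersetCard.1 he').1

/-- The restriction of the cochain map to a set of triangles, modulo coboundaries. -/
noncomputable def restrictClass (Φ : Z →ₗ[F] (Finset V → F)) (S : Finset (Finset V)) :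
    Z →ₗ[F] (S → F) ⧸ LinearMap.range (coboundary₁ F (edgesOf S) S) :=
  Submodule.mkQ _ ∘ₗ LinearMap.funLeft F F (Subtype.val : S → Finset V) ∘ₗ Φ

lemma restrictClass_eq_zero_iff (z : Z) : restrictClass Φ S z = 0 ↔
    ∃ b : Finset V → F, ∀ t ∈ S, Φ z t = ∑ e ∈ Finset.powersetCard 2 t, b e := by
  rw [restrictClass, LinearMap.comp_apply, Submodule.mkQ_apply, Submodule.Quotient.mk_eq_zero]
  constructor
  · rintro ⟨x, hx⟩
    refine ⟨fun e => if h : e ∈ edgesOf S then x ⟨e, h⟩ else 0, fun t ht => ?_⟩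
    exact (congrFun hx ⟨t, ht⟩).symm
  · rintro ⟨b, hb⟩
    refine ⟨fun e => b e, ?_⟩
    ext t
    rw [coboundary₁_restrict, ← hb t t.2]
    rfl

-- By minimality at `t`, some `z` outside `B` becomes a coboundary `δb` off `t`. Then `Φ z - δb` is
-- a non-zero multiple of the indicator of `t`, so every indicator is hit modulo coboundaries.
include hS hmin in
lemma restrictClass_surjective : Function.Surjective (restrictClass Φ S) := by
  rw [← LinearMap.range_eq_top, ← top_le_iff]
  have hsingle (t : S) : Submodule.Quotient.mk (Pi.single t 1) ∈
      LinearMap.range (restrictClass Φ S) := by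
    have h := hmin t t.2
    simp only [Detects, not_forall, exists_prop] at h
    obtain ⟨z, ⟨b, hb⟩, hz⟩ := h
    set c := Φ z t - ∑ e ∈ Finset.powersetCard 2 (t : Finset V), b e with hc
    have hc0 : c ≠ 0 := by
      intro h0
      refine hz (hS z ⟨b, fun t' ht' => ?_⟩)
      obtain rfl | hne := eq_or_ne t' t
      · exact sub_eq_zero.1 h0
      · exact hb t' (Finset.mem_erase.2 ⟨hne, ht'⟩)
    refine ⟨c⁻¹ • z, ?_⟩
    rw [map_smul, inv_smul_eq_iff₀ hc0, ← Submodule.Quotient.mk_smul]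
    refine (Submodule.Quotient.eq _).2 ⟨fun e => b e, ?_⟩
    ext t'
    rw [coboundary₁_restrict]
    change _ = Φ z t' - c * (Pi.single t 1 : S → F) t'
    obtain rfl | hne := eq_or_ne t' t
    · rw [Pi.single_eq_same, hc]
      ring
    · rw [Pi.single_eq_of_ne hne, hb t' (Finset.mem_erase.2 ⟨fun h => hne (Subtype.ext h), t'.2⟩)]
      ring
  rintro x -
  obtain ⟨x, rfl⟩ := Submodule.Quotient.mk_surjective _ x
  rw [pi_eq_sum_univ' x]
  change Submodule.mkQ _ _ ∈ _
  rw [map_sum]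
  refine Submodule.sum_mem _ fun t _ => ?_
  rw [map_smul]
  refine Submodule.smul_mem _ _ ?_
  exact hsingle t

include hS hmin in
lemma finrank_quotient_add_finrank_range
    (hB : ∀ z ∈ B, ∃ b : Finset V → F, ∀ t ∈ S, Φ z t = ∑ e ∈ Finset.powersetCard 2 t, b e) :
    Module.finrank F (Z ⧸ B) +
      Module.finrank F (LinearMap.range (coboundary₁ F (edgesOf S) S)) = S.card := by
  have hker : LinearMap.ker (restrictClass Φ S) = B := by
    ext z
    rw [LinearMap.mem_ker, restrictClass_eq_zero_iff]
    exact ⟨hS z, hB z⟩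
  have e := (restrictClass Φ S).quotKerEquivOfSurjective (restrictClass_surjective hS hmin)
  rw [hker] at e
  rw [e.finrank_eq, Submodule.finrank_quotient_add_finrank, Module.finrank_fintype_fun_eq_card,
    Fintype.card_coe]

end Detecting

/-! ### Counting cocycles of degree one. -/

section FirstCohomology

variable {V : Type*} [DecidableEq V] {F : Type*} [Field F] [CharP F 2]
  {H : Type*} [AddCommGroup H] [Module F H]

/-- The image of `H` and the coboundaries of vertex functions are independent subspaces of the
1-cocycles on `S`; rank-nullity bounds the latter. -/
lemma finrank_add_finrank_range_add_finrank_range_le {S : Finset (Finset V)}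
    (hS : ∀ t ∈ S, t.card = 3) (Ψ : H →ₗ[F] (Finset V → F))
    (hΨ : ∀ a, ∀ t ∈ S, ∑ e ∈ Finset.powersetCard 2 t, Ψ a e = 0)
    (hinj : ∀ a, (∃ f : V → F, ∀ e ∈ edgesOf S, Ψ a e = ∑ v ∈ e, f v) → a = 0) :
    Module.finrank F H + Module.finrank F (LinearMap.range (coboundary₀ F (edgesOf S))) +
      Module.finrank F (LinearMap.range (coboundary₁ F (edgesOf S) S)) ≤ (edgesOf S).card := by
  let res : H →ₗ[F] (edgesOf S → F) := LinearMap.funLeft F F Subtype.val ∘ₗ Ψ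
  have hres0 (a : H) (ha : res a ∈ LinearMap.range (coboundary₀ F (edgesOf S))) : a = 0 := by
    obtain ⟨f, hf⟩ := ha
    exact hinj a ⟨f, fun e he => (congrFun hf ⟨e, he⟩).symm⟩
  have hres : Function.Injective res := by
    rw [← LinearMap.ker_eq_bot, LinearMap.ker_eq_bot']
    exact fun a ha => hres0 a (ha ▸ Submodule.zero_mem _)
  have hdisj : Disjoint (LinearMap.range res) (LinearMap.range (coboundary₀ F (edgesOf S))) := by
    rw [Submodule.disjoint_def]
    rintro _ ⟨a, rfl⟩ ha
    rw [hres0 a ha, map_zero]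
  have hle : LinearMap.range res ⊔ LinearMap.range (coboundary₀ F (edgesOf S)) ≤
      LinearMap.ker (coboundary₁ F (edgesOf S) S) := by
    refine sup_le ?_ ?_
    · rintro _ ⟨a, rfl⟩
      rw [LinearMap.mem_ker]
      ext t
      exact (coboundary₁_restrict S (Ψ a) t).trans (hΨ a t t.2)
    · rintro _ ⟨f, rfl⟩
      exact coboundary₁_comp_coboundary₀ hS f
  have h1 := Submodule.finrank_sup_add_finrank_inf_eq (LinearMap.range res)
    (LinearMap.range (coboundary₀ F (edgesOf S)))
  rw [hdisj.eq_bot, finrank_bot, add_zero, LinearMap.finrank_range_of_inj hres] at h1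
  have h2 := Submodule.finrank_mono hle
  have h3 := LinearMap.finrank_range_add_finrank_ker (coboundary₁ F (edgesOf S) S)
  rw [Module.finrank_fintype_fun_eq_card, Fintype.card_coe] at h3
  omega

end FirstCohomology

/-- The bound `4 ≤ m` makes `2m - 7` positive and so selects the larger root of the quadratic. -/
lemma rho_le_of_sq_le {k m : ℤ} (hm : 4 ≤ m) (h : 49 - 24 * k ≤ (2 * m - 7) ^ 2) : rho k ≤ m := by
  rw [rho, Int.ceil_le]
  have hm' : (4 : ℝ) ≤ m := by exact_mod_cast hm
  have h' : (49 - 24 * k : ℝ) ≤ (2 * m - 7) ^ 2 := by exact_mod_cast h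
  have := (Real.sqrt_le_left (by linarith : (0 : ℝ) ≤ 2 * m - 7)).2 h'
  linarith

/-- If a set of triangles detects a non-zero space of classes of degree two, minimally, and the
classes of degree one inject, then there are at least as many triangles as in a minimal
triangulation of a closed surface. -/
theorem rho_le_card_of_detects {V : Type*} [DecidableEq V] {F : Type*} [Field F] [CharP F 2]
    {Z H : Type*} [AddCommGroup Z] [Module F Z] [AddCommGroup H] [Module F H]
    {Φ : Z →ₗ[F] (Finset V → F)} {B : Submodule F Z} {S : Finset (Finset V)}
    (hS3 : ∀ t ∈ S, t.card = 3) (hS : Detects Φ B S)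
    (hmin : ∀ t ∈ S, ¬ Detects Φ B (S.erase t))
    (hB : ∀ z ∈ B, ∃ b : Finset V → F, ∀ t ∈ S, Φ z t = ∑ e ∈ Finset.powersetCard 2 t, b e)
    (hne : B ≠ ⊤) (Ψ : H →ₗ[F] (Finset V → F))
    (hΨ : ∀ a, ∀ t ∈ S, ∑ e ∈ Finset.powersetCard 2 t, Ψ a e = 0)
    (hinj : ∀ a, (∃ f : V → F, ∀ e ∈ edgesOf S, Ψ a e = ∑ v ∈ e, f v) → a = 0) :
    2 * rho (Module.finrank F (Z ⧸ B) - Module.finrank F H + 1) -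
      2 * (Module.finrank F (Z ⧸ B) - Module.finrank F H + 1) ≤ S.card := by
  have hdeg := exists_other_triangle hS hmin
  have hSne : S.Nonempty := by
    rw [Finset.nonempty_iff_ne_empty]
    rintro rfl
    exact hne (top_le_iff.1 fun z _ => hS z ⟨0, by simp⟩)
  have h1 := finrank_quotient_add_finrank_range hS hmin hB
  have h2 := finrank_add_finrank_range_add_finrank_range_le hS3 Ψ hΨ hinj
  have h3 := two_mul_card_edgesOf_le hS3 hdeg
  have h4 := four_le_card_edgesOf hS3 hdeg hSne
  have h5 := two_mul_card_edges_le (F := F) (edgesOf S) fun e he => card_of_mem_edgesOf he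
  generalize Module.finrank F (LinearMap.range (coboundary₀ F (edgesOf S))) = r at *
  generalize Module.finrank F (LinearMap.range (coboundary₁ F (edgesOf S) S)) = r₁ at *
  generalize Module.finrank F (Z ⧸ B) = a at *
  generalize Module.finrank F H = b at *
  generalize (edgesOf S).card = N at *
  generalize S.card = M at *
  -- Rank at most two would allow at most three edges, but there are at least four.
  have hr : 3 ≤ r := by
    by_contra! hr
    have : r * (r + 1) ≤ 2 * 3 := Nat.mul_le_mul (by omega) (by omega)
    omega
  -- Here `r + 1` stands in for the number of vertices, so no connectedness of `S` is required.
  have h6 : 3 * ((r : ℤ) + 1) - 3 * (a - b + 1) ≤ N := by omega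
  have hle := rho_le_of_sq_le (k := a - b + 1) (m := r + 1) (by omega) (by zify at h5; nlinarith)
  omega

/-! ### Group cohomology as the dual of group homology -/

section Duality

open Module

variable {F : Type*} [Field F] {C₁ C₂ C₃ D₁ D₂ D₃ H H' : Type*}
  [AddCommGroup C₁] [Module F C₁] [AddCommGroup C₂] [Module F C₂] [AddCommGroup C₃] [Module F C₃]
  [AddCommGroup D₁] [Module F D₁] [AddCommGroup D₂] [Module F D₂] [AddCommGroup D₃] [Module F D₃]
  [AddCommGroup H] [Module F H] [AddCommGroup H'] [Module F H']

/-- The cohomology of the dual of a complex of vector spaces is the dual of its homology. -/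
theorem nonempty_equiv_dual_homology
    (d₃ : C₃ →ₗ[F] C₂) (d₂ : C₂ →ₗ[F] C₁) (hd : ∀ x, d₂ (d₃ x) = 0)
    (δ₂ : D₁ →ₗ[F] D₂) (δ₃ : D₂ →ₗ[F] D₃)
    (e₁ : D₁ ≃ₗ[F] Dual F C₁) (e₂ : D₂ ≃ₗ[F] Dual F C₂) (e₃ : D₃ ≃ₗ[F] Dual F C₃)
    (h₂ : ∀ y x, e₂ (δ₂ y) x = e₁ y (d₂ x)) (h₃ : ∀ y x, e₃ (δ₃ y) x = e₂ y (d₃ x))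
    (p : LinearMap.ker d₂ →ₗ[F] H) (hp : Function.Surjective p)
    (hp0 : ∀ x, p x = 0 ↔ (x : C₂) ∈ LinearMap.range d₃)
    (p' : LinearMap.ker δ₃ →ₗ[F] H') (hp' : Function.Surjective p')
    (hp0' : ∀ y, p' y = 0 ↔ (y : D₂) ∈ LinearMap.range δ₂) :
    Nonempty (H' ≃ₗ[F] Dual F H) := by
  let κ : LinearMap.ker δ₃ →ₗ[F] Dual F (LinearMap.ker d₂) :=
    (LinearMap.ker d₂).subtype.dualMap ∘ₗ e₂.toLinearMap ∘ₗ (LinearMap.ker δ₃).subtype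
  have hκ (y : LinearMap.ker δ₃) (x : LinearMap.ker d₂) : κ y x = e₂ y x := rfl
  -- A functional that vanishes on cycles factors through `d₂`, that is, it is a coboundary.
  have hker : LinearMap.ker κ = LinearMap.ker p' := by
    ext y
    rw [LinearMap.mem_ker, LinearMap.mem_ker, hp0']
    constructor
    · intro hy
      have : e₂ y ∈ LinearMap.range d₂.dualMap := by
        rw [LinearMap.range_dualMap_eq_dualAnnihilator_ker, Submodule.mem_dualAnnihilator]
        exact fun x hx => by rw [← hκ y ⟨x, hx⟩, hy]; rfl
      obtain ⟨ℓ, hℓ⟩ := this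
      refine ⟨e₁.symm ℓ, e₂.injective (LinearMap.ext fun x => ?_)⟩
      rw [h₂, e₁.apply_symm_apply, ← hℓ]
      rfl
    · rintro ⟨w, hw⟩
      ext x
      rw [hκ, ← hw, h₂, LinearMap.mem_ker.1 x.2, map_zero]
      rfl
  -- A functional on cycles that kills boundaries extends to all chains, over a field, and the
  -- extension is a cocycle.
  have hrange : LinearMap.range κ = LinearMap.range p.dualMap := by
    rw [LinearMap.range_dualMap_eq_dualAnnihilator_ker]
    ext ℓ
    rw [Submodule.mem_dualAnnihilator]
    constructor
    · rintro ⟨y, rfl⟩ x hx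
      obtain ⟨w, hw⟩ := (hp0 x).1 hx
      rw [hκ, ← hw, ← h₃, LinearMap.mem_ker.1 y.2, map_zero]
      rfl
    · intro hℓ
      obtain ⟨ℓ', hℓ'⟩ := LinearMap.exists_extend ℓ
      have hval (x : LinearMap.ker d₂) : ℓ' x = ℓ x := LinearMap.congr_fun hℓ' x
      refine ⟨⟨e₂.symm ℓ', e₃.injective (LinearMap.ext fun x => ?_)⟩, LinearMap.ext fun x => ?_⟩
      · rw [h₃, e₂.apply_symm_apply, map_zero, hval ⟨d₃ x, hd x⟩, hℓ _ ((hp0 _).2 ⟨x, rfl⟩)]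
        rfl
      · rw [hκ, e₂.apply_symm_apply, hval]
  exact ⟨(p'.quotKerEquivOfSurjective hp').symm ≪≫ₗ Submodule.quotEquivOfEq _ _ hker.symm ≪≫ₗ
    κ.quotKerEquivRange ≪≫ₗ LinearEquiv.ofEq _ _ hrange ≪≫ₗ
    (LinearEquiv.ofInjective _ (LinearMap.dualMap_injective_of_surjective hp)).symm⟩

end Duality

instance : CharP F2.{u} 2 := inferInstanceAs (CharP (ULift.{u} (ZMod 2)) 2)

/-! ### Duality in degrees one and two over the field with two elements. -/

section

variable (G : Type u) [Group G]

/-- Functions on a set as functionals on the finitely supported functions. -/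
noncomputable def evalEquiv (X : Type u) :
    (X → F2.{u}) ≃ₗ[F2.{u}] Module.Dual F2.{u} (X →₀ F2.{u}) :=
  Finsupp.llift F2.{u} F2.{u} F2.{u} X

lemma evalEquiv_single {X : Type u} (f : X → F2.{u}) (x : X) (a : F2.{u}) :
    evalEquiv X f (Finsupp.single x a) = a * f x := by
  simp [evalEquiv]

lemma evalEquiv_d₁₂ (y : G → F2.{u}) (x : G × G →₀ F2.{u}) :
    evalEquiv (G × G) ((groupCohomology.d₁₂ (trivF2 G)).hom y) x =
      evalEquiv G y ((groupHomology.d₂₁ (trivF2 G)).hom x) := by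
  induction x using Finsupp.induction_linear with
  | zero => rw [map_zero, map_zero, map_zero]
  | add x x' h h' => rw [map_add, map_add, map_add, h, h']
  | single x a =>
    refine (evalEquiv_single _ x a).trans (Eq.trans ?_ (congrArg (evalEquiv _ y)
      (groupHomology.d₂₁_single (A := trivF2 G) x a).symm))
    change a * (y x.2 - y (x.1 * x.2) + y x.1) = evalEquiv _ y (Finsupp.single x.2 a -
      Finsupp.single (x.1 * x.2) a + Finsupp.single x.1 a)
    simp only [map_add, map_sub, evalEquiv_single]
    ring

theorem nonempty_cohomologyF2_two_equiv :
    Nonempty (cohomologyF2 G 2 ≃ₗ[F2.{u}] Module.Dual F2.{u} (homologyF2 G 2)) := by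
  refine nonempty_equiv_dual_homology (groupHomology.d₃₂ (trivF2 G)).hom
    (groupHomology.d₂₁ (trivF2 G)).hom
    (fun x => LinearMap.congr_fun (congrArg ModuleCat.Hom.hom
      (groupHomology.d₃₂_comp_d₂₁ (trivF2 G))) x)
    (groupCohomology.d₁₂ (trivF2 G)).hom (groupCohomology.d₂₃ (trivF2 G)).hom
    (evalEquiv G) (evalEquiv (G × G)) (evalEquiv (G × G × G)) ?_ ?_
    (groupHomology.H2π (trivF2 G)).hom ((ModuleCat.epi_iff_surjective _).1 inferInstance)
    groupHomology.H2π_eq_zero_iff (groupCohomology.H2π (trivF2 G)).hom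
    ((ModuleCat.epi_iff_surjective _).1 inferInstance) groupCohomology.H2π_eq_zero_iff
  · exact evalEquiv_d₁₂ G
  · intro y x
    induction x using Finsupp.induction_linear with
    | zero => rw [map_zero, map_zero, map_zero]
    | add x x' h h' => rw [map_add, map_add, map_add, h, h']
    | single x a =>
      refine (evalEquiv_single _ x a).trans (Eq.trans ?_ (congrArg (evalEquiv _ y)
        (groupHomology.d₃₂_single (A := trivF2 G) x a).symm))
      change a * (y (x.2.1, x.2.2) - y (x.1 * x.2.1, x.2.2) + y (x.1, x.2.1 * x.2.2) -
        y (x.1, x.2.1)) = evalEquiv _ y (Finsupp.single (x.2.1, x.2.2) a -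
        Finsupp.single (x.1 * x.2.1, x.2.2) a + Finsupp.single (x.1, x.2.1 * x.2.2) a -
        Finsupp.single (x.1, x.2.1) a)
      simp only [map_add, map_sub, evalEquiv_single]
      ring

theorem nonempty_cohomologyF2_one_equiv :
    Nonempty (cohomologyF2 G 1 ≃ₗ[F2.{u}] Module.Dual F2.{u} (homologyF2 G 1)) := by
  refine nonempty_equiv_dual_homology (groupHomology.d₂₁ (trivF2 G)).hom
    (groupHomology.d₁₀ (trivF2 G)).hom
    (fun x => LinearMap.congr_fun (congrArg ModuleCat.Hom.hom
      (groupHomology.d₂₁_comp_d₁₀ (trivF2 G))) x)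
    (groupCohomology.d₀₁ (trivF2 G)).hom (groupCohomology.d₁₂ (trivF2 G)).hom
    (LinearMap.ringLmapEquivSelf F2.{u} F2.{u} F2.{u}).symm (evalEquiv G) (evalEquiv (G × G)) ?_ ?_
    (groupHomology.H1π (trivF2 G)).hom ((ModuleCat.epi_iff_surjective _).1 inferInstance)
    groupHomology.H1π_eq_zero_iff (groupCohomology.H1π (trivF2 G)).hom
    ((ModuleCat.epi_iff_surjective _).1 inferInstance) groupCohomology.H1π_eq_zero_iff
  · intro y x
    rw [groupCohomology.d₀₁_eq_zero, groupHomology.d₁₀_eq_zero_of_isTrivial]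
    exact (LinearMap.congr_fun (map_zero (evalEquiv G)) x).trans (map_zero _).symm
  · exact evalEquiv_d₁₂ G

lemma finrank_homologyF2_zero : Module.finrank F2.{u} (homologyF2 G 0) = 1 := by
  rw [(groupHomology.H0IsoOfIsTrivial (trivF2 G)).toLinearEquiv.finrank_eq]
  exact Module.finrank_self _

end

/-! ### Extensions by a `2`-cocycle -/

section Extension

variable {G A : Type*} [Group G] [AddCommGroup A]

/-- The set underlying the extension of `G` by `A` given by the `2`-cocycle `z`. -/
@[ext]
structure TwistedProduct (z : G × G → A) where
  /-- the component in `A` -/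
  fst : A
  /-- the component in `G` -/
  snd : G

/-- The extension of `G` by the trivial module `A` given by the `2`-cocycle `z`. -/
@[reducible]
def TwistedProduct.group {z : G × G → A}
    (hz : ∀ g h j, z (g * h, j) + z (g, h) = z (h, j) + z (g, h * j)) :
    Group (TwistedProduct z) :=
  letI : Mul (TwistedProduct z) := ⟨fun x y => ⟨x.1 + y.1 + z (x.2, y.2), x.2 * y.2⟩⟩
  -- The cocycle is not assumed normalized, so the identity carries the correction `-z (1, 1)`.
  letI : One (TwistedProduct z) := ⟨⟨-z (1, 1), 1⟩⟩
  letI : Inv (TwistedProduct z) := ⟨fun x => ⟨-x.1 - z (x.2⁻¹, x.2) - z (1, 1), x.2⁻¹⟩⟩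
  Group.ofLeftAxioms
    (fun x y w => TwistedProduct.ext (by
      change x.1 + y.1 + z (x.2, y.2) + w.1 + z (x.2 * y.2, w.2) =
        x.1 + (y.1 + w.1 + z (y.2, w.2)) + z (x.2, y.2 * w.2)
      have h := hz x.2 y.2 w.2
      calc _ = x.1 + y.1 + w.1 + (z (x.2 * y.2, w.2) + z (x.2, y.2)) := by abel
        _ = _ := by rw [h]; abel) (mul_assoc _ _ _))
    (fun x => TwistedProduct.ext (by
      change -z (1, 1) + x.1 + z (1, x.2) = x.1
      have h := hz 1 1 x.2
      rw [one_mul, one_mul, add_right_inj] at h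
      rw [h]; abel) (one_mul _))
    (fun x => TwistedProduct.ext (by
      change -x.1 - z (x.2⁻¹, x.2) - z (1, 1) + x.1 + z (x.2⁻¹, x.2) = -z (1, 1)
      abel) (inv_mul_cancel _))

/-- The `A`-component of a section, negated, is a cochain bounding `z`. -/
lemma exists_eq_of_splitting {z : G × G → A}
    (hz : ∀ g h j, z (g * h, j) + z (g, h) = z (h, j) + z (g, h * j)) :
    letI := TwistedProduct.group hz
    ∀ (s : G →* TwistedProduct z), (∀ g, (s g).snd = g) →
      ∃ x : G → A, ∀ g h, z (g, h) = x h - x (g * h) + x g := by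
  let := TwistedProduct.group hz
  intro s hs
  refine ⟨fun g => -(s g).fst, fun g h => ?_⟩
  have h1 : (s (g * h)).fst = (s g).fst + (s h).fst + z ((s g).snd, (s h).snd) :=
    congrArg TwistedProduct.fst (s.map_mul g h)
  rw [hs, hs] at h1
  simp only [h1]
  abel

end Extension

/-! ### Edge cocycles of a complex -/

section EdgeCocycle

variable {V : Type*} [LinearOrder V] {E : Type*} [Group E]

/-- A `1`-cocycle with values in a group on the complex with set of faces `K`. -/
def IsEdgeCocycle (K : Set (Finset V)) (g : V → V → E) : Prop :=
  ∀ a b c, {a, b, c} ∈ K → g a b * g b c = g a c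

/-- Triples with repeated vertices are allowed in the cocycle condition, and they encode
normalization and antisymmetry. -/
lemma IsEdgeCocycle.self {K : Set (Finset V)} {g : V → V → E} (hg : IsEdgeCocycle K g) {a : V}
    (ha : {a} ∈ K) : g a a = 1 := by
  have := hg a a a (by simpa using ha)
  simpa using this

lemma IsEdgeCocycle.swap {K : Set (Finset V)} {g : V → V → E} (hg : IsEdgeCocycle K g) {a b : V}
    (ha : {a} ∈ K) (hab : {a, b} ∈ K) : g a b = (g b a)⁻¹ := by
  have := hg a b a (by rwa [Finset.pair_comm b a, Finset.insert_idem])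
  rw [hg.self ha] at this
  exact eq_inv_of_mul_eq_one_left this

/-- The antisymmetric extension of a function on increasing pairs. -/
def antisymmExtend (g : V → V → E) (a b : V) : E :=
  if a < b then g a b else if b < a then (g b a)⁻¹ else 1

lemma antisymmExtend_of_lt (g : V → V → E) {a b : V} (h : a < b) : antisymmExtend g a b = g a b :=
  if_pos h

lemma antisymmExtend_self (g : V → V → E) (a : V) : antisymmExtend g a a = 1 := by
  simp [antisymmExtend]

lemma antisymmExtend_swap (g : V → V → E) (a b : V) :
    antisymmExtend g b a = (antisymmExtend g a b)⁻¹ := by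
  rcases lt_trichotomy a b with h | rfl | h
  · simp [antisymmExtend, h, h.not_gt]
  · simp [antisymmExtend]
  · simp [antisymmExtend, h, h.not_gt]

/-- Every ordering of a triangle reduces to the increasing one by inverting factors. This lets a
cochain given on unordered edges define a group-valued cocycle. -/
lemma isEdgeCocycle_antisymmExtend {K : Set (Finset V)} {g : V → V → E}
    (hg : ∀ a b c, a < b → b < c → {a, b, c} ∈ K → g a b * g b c = g a c) :
    IsEdgeCocycle K (antisymmExtend g) := by
  set k := antisymmExtend g with hk
  have hk' (a b c : V) (hab : a < b) (hbc : b < c) (h : {a, b, c} ∈ K) : k a b * k b c = k a c := by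
    rw [hk, antisymmExtend_of_lt _ hab, antisymmExtend_of_lt _ hbc,
      antisymmExtend_of_lt _ (hab.trans hbc)]
    exact hg a b c hab hbc h
  have hself (a : V) : k a a = 1 := antisymmExtend_self g a
  have hswap (a b : V) : k b a = (k a b)⁻¹ := antisymmExtend_swap g a b
  have h132 (a b c : V) : ({a, c, b} : Finset V) = {a, b, c} := by
    rw [Finset.pair_comm]
  have h213 (a b c : V) : ({b, a, c} : Finset V) = {a, b, c} := Finset.insert_comm _ _ _
  intro a b c h
  rcases lt_trichotomy a b with hab | rfl | hab
  · rcases lt_trichotomy b c with hbc | rfl | hbc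
    · exact hk' a b c hab hbc h
    · rw [hself, mul_one]
    · rcases lt_trichotomy a c with hac | rfl | hac
      · rw [hswap c b, ← hk' a c b hac hbc (by rwa [h132])]
        group
      · rw [hself, hswap a b, mul_inv_cancel]
      · rw [hswap c b, hswap c a, ← hk' c a b hac hab (by rwa [h213, h132])]
        group
  · rw [hself, one_mul]
  · rcases lt_trichotomy b c with hbc | rfl | hbc
    · rcases lt_trichotomy a c with hac | rfl | hac
      · rw [hswap b a, ← hk' b a c hab hac (by rwa [h213])]
        group
      · rw [hself, hswap b a, inv_mul_cancel]
      · rw [hswap b a, hswap c a, ← hk' b c a hbc hac (by rwa [h132, h213])]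
        group
    · rw [hself, mul_one]
    · rw [hswap b a, hswap c b, hswap c a, ← hk' c b a hbc hab
        (by rwa [h132, h213, h132])]
      group

end EdgeCocycle

/-! ### Pulling back group cochains along an edge cocycle -/

section Pullback

variable {V : Type*} [LinearOrder V] {F : Type*} [Field F] {G : Type*}

/-- The pullback of a function on `G` to a `1`-cochain. -/
def pullback₁ (F : Type*) [Field F] (g : V → V → G) : (G → F) →ₗ[F] (Finset V → F) where
  toFun x e := ∑ p ∈ (e ×ˢ e).filter (fun p => p.1 < p.2), x (g p.1 p.2)
  map_add' x y := by ext; simp [Finset.sum_add_distrib]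
  map_smul' c x := by ext; simp [Finset.mul_sum]

/-- The pullback of a function on `G × G` to a `2`-cochain. -/
def pullback₂ (F : Type*) [Field F] (g : V → V → G) : (G × G → F) →ₗ[F] (Finset V → F) where
  toFun z t := ∑ p ∈ (t ×ˢ t ×ˢ t).filter (fun p => p.1 < p.2.1 ∧ p.2.1 < p.2.2),
    z (g p.1 p.2.1, g p.2.1 p.2.2)
  map_add' x y := by ext; simp [Finset.sum_add_distrib]
  map_smul' c x := by ext; simp [Finset.mul_sum]

lemma pullback₁_pair (g : V → V → G) (x : G → F) {a b : V} (hab : a < b) :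
    pullback₁ F g x {a, b} = x (g a b) := by
  have : (({a, b} : Finset V) ×ˢ {a, b}).filter (fun p => p.1 < p.2) = {(a, b)} := by
    ext ⟨p, q⟩
    simp only [Finset.mem_filter, Finset.mem_product, Finset.mem_insert, Finset.mem_singleton,
      Prod.mk.injEq]
    grind
  change ∑ p ∈ (({a, b} : Finset V) ×ˢ {a, b}).filter (fun p => p.1 < p.2), _ = _
  rw [this, Finset.sum_singleton]

lemma pullback₂_triple (g : V → V → G) (z : G × G → F) {a b c : V} (hab : a < b) (hbc : b < c) :
    pullback₂ F g z {a, b, c} = z (g a b, g b c) := by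
  have : (({a, b, c} : Finset V) ×ˢ ({a, b, c} : Finset V) ×ˢ ({a, b, c} : Finset V)).filter
      (fun p => p.1 < p.2.1 ∧ p.2.1 < p.2.2) = {(a, b, c)} := by
    ext ⟨p, q, r⟩
    simp only [Finset.mem_filter, Finset.mem_product, Finset.mem_insert, Finset.mem_singleton,
      Prod.mk.injEq]
    grind
  change ∑ p ∈ (({a, b, c} : Finset V) ×ˢ ({a, b, c} : Finset V) ×ˢ
    ({a, b, c} : Finset V)).filter (fun p => p.1 < p.2.1 ∧ p.2.1 < p.2.2), _ = _
  rw [this, Finset.sum_singleton]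

lemma sum_powersetCard_two_triple (x : Finset V → F) {a b c : V} (hab : a < b) (hbc : b < c) :
    ∑ e ∈ Finset.powersetCard 2 {a, b, c}, x e = x {a, b} + x {b, c} + x {a, c} := by
  have h1 : ({a, b} : Finset V) ≠ {b, c} := fun h => by
    have : a ∈ ({b, c} : Finset V) := h ▸ Finset.mem_insert_self _ _
    grind
  have h2 : ({a, b} : Finset V) ≠ {a, c} := fun h => by
    have : b ∈ ({a, c} : Finset V) := h ▸ by simp
    grind
  have h3 : ({b, c} : Finset V) ≠ {a, c} := fun h => by
    have : b ∈ ({a, c} : Finset V) := h ▸ by simp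
    grind
  have h : Finset.powersetCard 2 {a, b, c} = {{a, b}, {b, c}, {a, c}} := by
    symm
    refine Finset.eq_of_subset_of_card_le ?_ ?_
    · intro e he
      simp only [Finset.mem_insert, Finset.mem_singleton] at he
      rw [Finset.mem_powersetCard]
      obtain rfl | rfl | rfl := he
      · exact ⟨by grind, Finset.card_pair hab.ne⟩
      · exact ⟨by grind, Finset.card_pair hbc.ne⟩
      · exact ⟨by grind, Finset.card_pair (hab.trans hbc).ne⟩
    · rw [Finset.card_powersetCard, Finset.card_eq_three.2 ⟨a, b, c, hab.ne, (hab.trans hbc).ne,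
        hbc.ne, rfl⟩, Finset.card_eq_three.2 ⟨_, _, _, h1, h2, h3, rfl⟩]
      decide
  rw [h, Finset.sum_insert (by simp [h1, h2]), Finset.sum_insert (by simpa using h3),
    Finset.sum_singleton, add_assoc]

lemma exists_lt_lt_of_card_eq_three {t : Finset V} (ht : t.card = 3) :
    ∃ a b c, a < b ∧ b < c ∧ t = {a, b, c} := by
  let f := t.orderEmbOfFin ht
  refine ⟨f 0, f 1, f 2, f.strictMono (by decide), f.strictMono (by decide), ?_⟩
  ext x
  rw [← Finset.mem_coe, ← Finset.range_orderEmbOfFin t ht, Set.mem_range, Fin.exists_fin_succ]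
  simp [Fin.exists_fin_succ, f, eq_comm]

end Pullback

/-! ### Compatibility of the pullback with coboundaries and cup products. -/

section Pullback

variable {V : Type*} [LinearOrder V] {F : Type*} [Field F] [CharP F 2] {G : Type u} [Group G]
  {K : Set (Finset V)} {g : V → V → G}

/-- Pullback is a cochain map: the edge cocycle condition turns `x (g a b * g b c)` into the value
on the third edge, and signs disappear in characteristic two. -/
lemma pullback₂_coboundary (hg : IsEdgeCocycle K g) (x : G → F) {t : Finset V} (htK : t ∈ K)
    (ht : t.card = 3) :
    pullback₂ F g (fun p => x p.2 - x (p.1 * p.2) + x p.1) t =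
      ∑ e ∈ Finset.powersetCard 2 t, pullback₁ F g x e := by
  obtain ⟨a, b, c, hab, hbc, rfl⟩ := exists_lt_lt_of_card_eq_three ht
  rw [pullback₂_triple g _ hab hbc, sum_powersetCard_two_triple _ hab hbc, pullback₁_pair g x hab,
    pullback₁_pair g x hbc, pullback₁_pair g x (hab.trans hbc), hg a b c htK, CharTwo.sub_eq_add]
  ring

lemma sum_pullback₁_hom (hg : IsEdgeCocycle K g) (x : Additive G →+ F) {t : Finset V} (htK : t ∈ K)
    (ht : t.card = 3) :
    ∑ e ∈ Finset.powersetCard 2 t, pullback₁ F g (fun h => x (Additive.ofMul h)) e = 0 := by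
  rw [← pullback₂_coboundary hg _ htK ht]
  obtain ⟨a, b, c, hab, hbc, rfl⟩ := exists_lt_lt_of_card_eq_three ht
  rw [pullback₂_triple g _ hab hbc, ofMul_mul, map_add]
  ring

/-- If a class of degree one vanishes on the edges of a triangle, so do its cup products. -/
lemma pullback₂_mul_eq_sum (hg : IsEdgeCocycle K g) (x y : Additive G →+ F) (f : V → F)
    {t : Finset V} (htK : t ∈ K) (ht : t.card = 3)
    (hf : ∀ e ∈ Finset.powersetCard 2 t,
      pullback₁ F g (fun h => x (Additive.ofMul h)) e = ∑ v ∈ e, f v) :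
    pullback₂ F g (fun p => x (Additive.ofMul p.1) * y (Additive.ofMul p.2)) t =
      ∑ e ∈ Finset.powersetCard 2 t,
        ∑ p ∈ (e ×ˢ e).filter (fun p => p.1 < p.2), f p.1 * y (Additive.ofMul (g p.1 p.2)) := by
  obtain ⟨a, b, c, hab, hbc, rfl⟩ := exists_lt_lt_of_card_eq_three ht
  have hac := hab.trans hbc
  have hpair {a b : V} (hab : a < b) : ∑ p ∈ (({a, b} : Finset V) ×ˢ {a, b}).filter
      (fun p => p.1 < p.2), f p.1 * y (Additive.ofMul (g p.1 p.2)) =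
      f a * y (Additive.ofMul (g a b)) :=
    pullback₁_pair (fun a b => (a, b)) (fun p => f p.1 * y (Additive.ofMul (g p.1 p.2))) hab
  have hxab := hf {a, b} (Finset.mem_powersetCard.2 ⟨by grind, Finset.card_pair hab.ne⟩)
  rw [pullback₁_pair g _ hab, Finset.sum_pair hab.ne] at hxab
  have hyac : y (Additive.ofMul (g a c)) =
      y (Additive.ofMul (g a b)) + y (Additive.ofMul (g b c)) := by
    rw [← hg a b c htK, ofMul_mul, map_add]
  -- The Leibniz rule `δf ∪ y = δ(f ∪ y)` for the cocycle `y`, where `f ∪ y` evaluates `f` at the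
  -- smaller endpoint.
  rw [pullback₂_triple g _ hab hbc, sum_powersetCard_two_triple _ hab hbc, hpair hab, hpair hbc,
    hpair hac, hxab, hyac]
  linear_combination - CharTwo.add_self_eq_zero (f a * y (Additive.ofMul (g a b)))

end Pullback

/-! ### The triangles of a complex detect the second cohomology of the group. -/

section Detection

variable {V : Type*} [LinearOrder V] {G : Type u} [Group G] {K : Set (Finset V)} {g : V → V → G}

/-- Every group epimorphism onto `G` along which `g` lifts to an edge cocycle splits. -/
def SplitsLifts (K : Set (Finset V)) (g : V → V → G) : Prop :=
  ∀ (E : Type u) [Group E] (q : E →* G), Function.Surjective q → ∀ g' : V → V → E,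
    IsEdgeCocycle K g' → (∀ a b, {a, b} ∈ K → q (g' a b) = g a b) →
      ∃ s : G →* E, ∀ x, q (s x) = x

/-- The pullback of `2`-cocycles. -/
noncomputable def pullbackCocycle (g : V → V → G) :
    groupCohomology.cocycles₂ (trivF2 G) →ₗ[F2.{u}] (Finset V → F2.{u}) :=
  pullback₂ F2.{u} g ∘ₗ (groupCohomology.cocycles₂ (trivF2 G)).subtype

/-- A cochain `b` bounding the pullback of `z` is exactly what is needed to lift `g` to the
extension defined by `z`; the resulting splitting makes `z` a coboundary. -/
theorem detects_triangles (hK1 : ∀ a, {a} ∈ K)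
    (hg : IsEdgeCocycle K g) (hsplit : SplitsLifts K g) {T : Finset (Finset V)}
    (hT : ∀ t, t ∈ T ↔ t ∈ K ∧ t.card = 3) :
    Detects (pullbackCocycle g) (LinearMap.ker (groupCohomology.H2π (trivF2 G)).hom) T := by
  rintro ⟨z, hz⟩ ⟨b, hb⟩
  have hz' : ∀ g h j, z (g * h, j) + z (g, h) = z (h, j) + z (g, h * j) :=
    (groupCohomology.mem_cocycles₂_iff z).1 hz
  let := TwistedProduct.group hz'
  let q : TwistedProduct z →* G :=
    { toFun := TwistedProduct.snd
      map_one' := rfl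
      map_mul' := fun _ _ => rfl }
  let k : V → V → TwistedProduct z := fun a c => ⟨b {a, c}, g a c⟩
  have hk : IsEdgeCocycle K (antisymmExtend k) := by
    refine isEdgeCocycle_antisymmExtend fun a b' c hab hbc habc => ?_
    have ht : ({a, b', c} : Finset V).card = 3 :=
      Finset.card_eq_three.2 ⟨a, b', c, hab.ne, (hab.trans hbc).ne, hbc.ne, rfl⟩
    refine TwistedProduct.ext ?_ (hg a b' c habc)
    have h := hb _ ((hT _).2 ⟨habc, ht⟩)
    rw [sum_powersetCard_two_triple _ hab hbc] at h
    replace h : z (g a b', g b' c) = _ := (pullback₂_triple g z hab hbc).symm.trans h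
    change b {a, b'} + b {b', c} + z (g a b', g b' c) = b {a, c}
    rw [h]
    linear_combination CharTwo.add_self_eq_zero (b {a, b'} + b {b', c})
  obtain ⟨s, hs⟩ := hsplit (TwistedProduct z) q (fun x => ⟨⟨0, x⟩, rfl⟩) _ hk fun a c hac => by
    rcases lt_trichotomy a c with h | rfl | h
    · rw [antisymmExtend_of_lt _ h]
      rfl
    · rw [antisymmExtend_self, map_one, hg.self (hK1 a)]
    · rw [antisymmExtend_swap, map_inv, antisymmExtend_of_lt _ h, hg.swap (hK1 a) hac]
      rfl
  obtain ⟨x, hx⟩ := exists_eq_of_splitting hz' s hs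
  rw [LinearMap.mem_ker]
  refine (groupCohomology.H2π_eq_zero_iff _).2 ⟨x, ?_⟩
  ext ⟨h, j⟩
  exact (hx h j).symm

theorem rho_le_card_triangles (hK1 : ∀ a, {a} ∈ K)
    (hg : IsEdgeCocycle K g) (hsplit : SplitsLifts K g) {T : Finset (Finset V)}
    (hT : ∀ t, t ∈ T ↔ t ∈ K ∧ t.card = 3) (hA : PropertyA G)
    (hH2 : Nontrivial (homologyF2 G 2)) :
    2 * rho (truncEuler G) - 2 * truncEuler G ≤ T.card := by
  set B := LinearMap.ker (groupCohomology.H2π (trivF2 G)).hom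
  obtain ⟨S, hST, hS, hmin⟩ := exists_minimal_detects (detects_triangles hK1 hg hsplit hT)
  have hS3 : ∀ t ∈ S, t.card = 3 := fun t ht => ((hT t).1 (hST ht)).2
  have hSK : ∀ t ∈ S, t ∈ K := fun t ht => ((hT t).1 (hST ht)).1
  have hB : ∀ z ∈ B, ∃ b : Finset V → F2.{u},
      ∀ t ∈ S, pullbackCocycle g z t = ∑ e ∈ Finset.powersetCard 2 t, b e := by
    intro z hz
    obtain ⟨x, hx⟩ := (groupCohomology.H2π_eq_zero_iff z).1 (LinearMap.mem_ker.1 hz)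
    refine ⟨pullback₁ F2.{u} g x, fun t ht => ?_⟩
    rw [← pullback₂_coboundary hg x (hSK t ht) (hS3 t ht)]
    exact congrFun (congrArg (pullback₂ F2.{u} g) hx.symm) t
  obtain ⟨e₂⟩ := nonempty_cohomologyF2_two_equiv G
  obtain ⟨e₁⟩ := nonempty_cohomologyF2_one_equiv G
  have hsurj : Function.Surjective (groupCohomology.H2π (trivF2 G)).hom :=
    (ModuleCat.epi_iff_surjective _).1 inferInstance
  have hne : B ≠ ⊤ := by
    intro h
    obtain ⟨y, hy⟩ := exists_ne (0 : Module.Dual F2.{u} (homologyF2 G 2))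
    obtain ⟨z, hz⟩ := hsurj (e₂.symm y)
    have hz0 : z ∈ B := h ▸ Submodule.mem_top
    rw [LinearMap.mem_ker.1 hz0] at hz
    exact hy (e₂.symm.injective (by rw [← hz, map_zero]))
  let Ψ : cohomologyF2 G 1 →ₗ[F2.{u}] (Finset V → F2.{u}) :=
    { toFun := fun α => pullback₁ F2.{u} g fun h => classHom α (Additive.ofMul h)
      map_add' := fun α β => by
        rw [← map_add, map_add classHom]
        rfl
      map_smul' := fun c α => by
        rw [← map_smul, map_smul classHom]
        rfl }
  have hmain := rho_le_card_of_detects hS3 hS hmin hB hne Ψ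
    (fun α t ht => sum_pullback₁_hom hg (classHom α) (hSK t ht) (hS3 t ht))
    (fun α ⟨f, hf⟩ => by
      by_contra hα
      obtain ⟨β, hβ⟩ := hA α hα
      -- If `α` is a coboundary on the edges of `S`, then `α ∪ β` is one on `S`, and detection
      -- forces it to vanish in the cohomology of `G`.
      have hcup := hS (cupCocycle (classHom α) (classHom β)) ⟨fun e =>
        ∑ p ∈ (e ×ˢ e).filter (fun p => p.1 < p.2), f p.1 * classHom β (Additive.ofMul (g p.1 p.2)),
        fun t ht => pullback₂_mul_eq_sum hg (classHom α) (classHom β) f (hSK t ht) (hS3 t ht)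
          fun e he => hf e (Finset.mem_biUnion.2 ⟨t, ht, he⟩)⟩
      exact hβ (LinearMap.mem_ker.1 hcup))
  have h2 : Module.finrank F2.{u} (groupCohomology.cocycles₂ (trivF2 G) ⧸ B) =
      Module.finrank F2.{u} (homologyF2 G 2) := by
    rw [← Subspace.dual_finrank_eq (V := homologyF2 G 2), ← e₂.finrank_eq]
    exact (LinearMap.quotKerEquivOfSurjective _ hsurj).finrank_eq
  have h1 : Module.finrank F2.{u} (cohomologyF2 G 1) = Module.finrank F2.{u} (homologyF2 G 1) := by
    rw [← Subspace.dual_finrank_eq (V := homologyF2 G 1), ← e₁.finrank_eq]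
  have hχ : truncEuler G = Module.finrank F2.{u} (groupCohomology.cocycles₂ (trivF2 G) ⧸ B) -
      Module.finrank F2.{u} (cohomologyF2 G 1) + 1 := by
    rw [truncEuler, finrank_homologyF2_zero, h1, h2]
    rfl
  rw [hχ]
  exact hmain.trans (by exact_mod_cast Finset.card_le_card hST)

end Detection

/-! ### Covering spaces from locally constant cocycles -/

section Monodromy

open unitInterval Topology Filter

variable {X : Type*} {ι : Type*} {U : ι → Set X}

/-- A function on the pairs `(t, i)` with `γ t ∈ U i` that is independent of `i` and locally
constant in `t` is constant. -/
lemma eq_of_locally_constant_on_cover {α : Type*} (hcover : ∀ x, ∃ i, x ∈ U i) (γ : I → X)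
    (D : I → ι → α) (hindep : ∀ t i j, γ t ∈ U i → γ t ∈ U j → D t i = D t j)
    (hloc : ∀ t₀ i, γ t₀ ∈ U i → ∀ᶠ t in 𝓝 t₀, γ t ∈ U i ∧ D t i = D t₀ i)
    {t t' : I} {i i' : ι} (hi : γ t ∈ U i) (hi' : γ t' ∈ U i') : D t i = D t' i' := by
  choose idx hidx using hcover
  have hf : IsLocallyConstant fun t => D t (idx (γ t)) := by
    rw [IsLocallyConstant.iff_eventually_eq]
    intro t₀
    filter_upwards [hloc t₀ _ (hidx (γ t₀))] with t ht
    rw [← ht.2]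
    exact hindep t _ _ (hidx _) ht.1
  rw [hindep t _ _ hi (hidx _), hindep t' _ _ hi' (hidx _)]
  exact hf.apply_eq_of_preconnectedSpace t t'

variable [TopologicalSpace X] {E : Type*} [Group E]

/-- The principal bundle with discrete fibre of a cocycle on an open cover. -/
def cocycleBundle [TopologicalSpace E] [DiscreteTopology E] (hU : ∀ i, IsOpen (U i)) (idx : X → ι)
    (hidx : ∀ x, x ∈ U (idx x)) (k : ι → ι → E)
    (hk : ∀ i j l, (U i ∩ U j ∩ U l).Nonempty → k i j * k j l = k i l) :
    FiberBundleCore ι X E where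
  baseSet := U
  isOpen_baseSet := hU
  indexAt := idx
  mem_baseSet_at := hidx
  coordChange i j _ e := e * k i j
  coordChange_self i x hx e := by
    have := hk i i i ⟨x, ⟨hx, hx⟩, hx⟩
    rw [mul_eq_left] at this
    rw [this, mul_one]
  continuousOn_coordChange i j :=
    ((continuous_of_discreteTopology (f := fun e : E => e * k i j)).comp
      continuous_snd).continuousOn
  coordChange_comp i j l x hx e := by rw [mul_assoc, hk i j l ⟨x, hx⟩]

/-- The cocycle glues a covering with fibre `E`, and `ψ` is its monodromy. The function `D` records
the chart coordinates of the lift of `γ` starting at `1`, so that later arguments need not mention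
the bundle. -/
lemma exists_monodromy (hU : ∀ i, IsOpen (U i)) (hcover : ∀ x, ∃ i, x ∈ U i) (k : ι → ι → E)
    (hk : ∀ i j l, (U i ∩ U j ∩ U l).Nonempty → k i j * k j l = k i l) {x₀ : X} {i₀ : ι}
    (hi₀ : x₀ ∈ U i₀) :
    ∃ ψ : Path.Homotopic.Quotient x₀ x₀ → E,
      (∀ c c', ψ (c.trans c') = ψ c * ψ c') ∧
      ∀ γ : Path x₀ x₀, ∃ D : I → ι → E,
        (∀ t i j, γ t ∈ U i → γ t ∈ U j → D t j = D t i * k i j) ∧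
        (∀ t₀ i, γ t₀ ∈ U i → ∀ᶠ t in 𝓝 t₀, γ t ∈ U i ∧ D t i = D t₀ i) ∧
        D 0 i₀ = 1 ∧ D 1 i₀ = ψ (.mk γ) := by
  let : TopologicalSpace E := ⊥
  have : DiscreteTopology E := ⟨rfl⟩
  choose idx hidx using hcover
  let Z := cocycleBundle hU idx hidx k hk
  have cov : IsCoveringMap Z.proj := FiberBundle.isCoveringMap (F := E) (E := Z.Fiber)
  have hcoord (i j : ι) (y : Z.TotalSpace) (hi : y.proj ∈ U i) (hj : y.proj ∈ U j) :
      (Z.localTriv j y).2 = (Z.localTriv i y).2 * k i j := by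
    change (show E from y.2) * k (idx y.proj) j = (show E from y.2) * k (idx y.proj) i * k i j
    rw [mul_assoc, hk _ _ _ ⟨y.proj, ⟨hidx _, hi⟩, hj⟩]
  have hloc (Γ : C(I, Z.TotalSpace)) (t₀ : I) (i : ι) (hi : (Γ t₀).proj ∈ U i) :
      ∀ᶠ t in 𝓝 t₀, (Γ t).proj ∈ U i ∧ (Z.localTriv i (Γ t)).2 = (Z.localTriv i (Γ t₀)).2 := by
    have hcont : ContinuousAt (fun t => (Z.localTriv i (Γ t)).2) t₀ :=
      continuous_snd.continuousAt.comp
        (((Z.localTriv i).continuousAt ((Z.mem_localTriv_source i _).2 hi)).comp Γ.2.continuousAt)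
    have hproj : ContinuousAt (fun t => (Γ t).proj) t₀ :=
      (cov.continuous.comp Γ.2).continuousAt
    exact (hproj.eventually_mem ((hU i).mem_nhds hi)).and
      (hcont.eventually_mem ((isOpen_discrete {_}).mem_nhds rfl))
  let y₀ : Z.proj ⁻¹' {x₀} := ⟨(Z.localTriv i₀).toOpenPartialHomeomorph.symm (x₀, 1), rfl⟩
  have hy₀ : (Z.localTriv i₀ y₀.1).2 = 1 := by
    exact congrArg Prod.snd ((Z.localTriv i₀).apply_symm_apply' hi₀)
  refine ⟨fun c => (Z.localTriv i₀ (cov.monodromy c y₀).1).2, fun c c' => ?_, fun γ => ?_⟩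
  · induction c' using Path.Homotopic.Quotient.ind with | mk γ => ?_
    dsimp only
    rw [cov.monodromy_trans_apply]
    set y₁ := cov.monodromy c y₀
    let Γ₀ := cov.liftPath γ y₀ (γ.source.trans y₀.2.symm)
    let Γ₁ := cov.liftPath γ y₁ (γ.source.trans y₁.2.symm)
    have hΓ₀ (t : I) : (Γ₀ t).proj = γ t := congrFun (cov.liftPath_lifts γ y₀ _) t
    have hΓ₁ (t : I) : (Γ₁ t).proj = γ t := congrFun (cov.liftPath_lifts γ y₁ _) t
    -- Transition functions multiply on the right, so they cancel in the ratio of the coordinates of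
    -- two lifts; this ratio is therefore constant along `γ`.
    have hconst := eq_of_locally_constant_on_cover (fun x => ⟨idx x, hidx x⟩) γ
      (fun t i => (Z.localTriv i (Γ₁ t)).2 * (Z.localTriv i (Γ₀ t)).2⁻¹)
      (fun t i j hi hj => by
        rw [hcoord i j (Γ₀ t) (by rwa [hΓ₀]) (by rwa [hΓ₀]),
          hcoord i j (Γ₁ t) (by rwa [hΓ₁]) (by rwa [hΓ₁])]
        group)
      (fun t₀ i hi => by
        filter_upwards [hloc Γ₀ t₀ i (by rwa [hΓ₀]), hloc Γ₁ t₀ i (by rwa [hΓ₁])] with t h0 h1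
        exact ⟨by rw [← hΓ₀]; exact h0.1, by rw [h0.2, h1.2]⟩)
      (t := 0) (t' := 1) (i := i₀) (i' := i₀) (by simpa using hi₀) (by simpa using hi₀)
    rw [cov.liftPath_zero, cov.liftPath_zero, hy₀, inv_one, mul_one] at hconst
    rw [hconst]
    exact (inv_mul_cancel_right _ _).symm
  · let Γ := cov.liftPath γ y₀ (γ.source.trans y₀.2.symm)
    have hΓ (t : I) : (Γ t).proj = γ t := congrFun (cov.liftPath_lifts γ y₀ _) t
    refine ⟨fun t i => (Z.localTriv i (Γ t)).2, fun t i j hi hj => ?_, fun t₀ i hi => ?_, ?_, rfl⟩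
    · exact hcoord i j _ (by rwa [hΓ]) (by rwa [hΓ])
    · filter_upwards [hloc Γ t₀ i (by rwa [hΓ])] with t h
      exact ⟨by rw [← hΓ]; exact h.1, h.2⟩
    · dsimp only
      rw [cov.liftPath_zero, hy₀]

end Monodromy

/-! ### Lifting homomorphisms of the fundamental group -/

section Lifting

open unitInterval Topology Filter

variable {X : Type*} [TopologicalSpace X] {G : Type*} [Group G]

/-- A homomorphism from the fundamental groupoid to a group, evaluated on paths. -/
structure PathHom (X : Type*) [TopologicalSpace X] (G : Type*) [Group G] where
  /-- the value on a path -/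
  toFun : ∀ {x y : X}, Path x y → G
  map_trans : ∀ {x y z : X} (γ : Path x y) (γ' : Path y z), toFun (γ.trans γ') = toFun γ * toFun γ'
  map_homotopic : ∀ {x y : X} {γ γ' : Path x y}, γ.Homotopic γ' → toFun γ = toFun γ'

namespace PathHom

lemma map_refl (F : PathHom X G) (x : X) : F.toFun (Path.refl x) = 1 := by
  have h := F.map_trans (Path.refl x) (Path.refl x)
  rw [Path.refl_trans_refl] at h
  exact left_eq_mul.1 h

lemma map_cast (F : PathHom X G) {x y x' y' : X} (γ : Path x y) (hx : x' = x) (hy : y' = y) :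
    F.toFun (γ.cast hx hy) = F.toFun γ := by
  subst hx hy
  rfl

lemma map_subpath (F : PathHom X G) {x y : X} (γ : Path x y) (r s t : I) :
    F.toFun (γ.subpath r t) = F.toFun (γ.subpath r s) * F.toFun (γ.subpath s t) := by
  rw [← F.map_trans]
  exact (F.map_homotopic ⟨Path.Homotopy.subpathTransSubpath γ r s t⟩).symm

/-- The extension to all paths of a homomorphism from the fundamental group, up to inversion and
conjugation, through chosen paths from the base point. -/
noncomputable def ofFundamentalGroup {x₀ : X} (φ : FundamentalGroup X x₀ →* G)
    (p : ∀ x, Path x₀ x) : PathHom X G where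
  -- Multiplication in `FundamentalGroup` reverses concatenation; the inverse restores the order.
  toFun {x y} γ := (φ (.fromPath (.mk (((p x).trans γ).trans (p y).symm))))⁻¹
  map_trans {x y z} γ γ' := by
    rw [← mul_inv_rev, ← map_mul, FundamentalGroup.mul_def, ← Path.Homotopic.Quotient.mk_trans]
    congr 2
    simp only [Path.Homotopic.Quotient.mk_trans, Path.Homotopic.Quotient.mk_symm,
      Path.Homotopic.Quotient.trans_assoc]
    rw [← Path.Homotopic.Quotient.trans_assoc (.symm _) _ (.trans _ _),
      Path.Homotopic.Quotient.symm_trans, Path.Homotopic.Quotient.refl_trans]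
  map_homotopic {x y γ γ'} h := by
    congr 3
    exact Path.Homotopic.Quotient.eq.2
      (((Path.Homotopic.refl _).hcomp h).hcomp (Path.Homotopic.refl _))

/-- The chosen path from `x₀` to itself may be an essential loop, hence the conjugation. -/
lemma ofFundamentalGroup_loop {x₀ : X} (φ : FundamentalGroup X x₀ →* G) (p : ∀ x, Path x₀ x)
    (γ : Path x₀ x₀) : (ofFundamentalGroup φ p).toFun γ =
      (φ (.fromPath (.mk (p x₀))))⁻¹ * (φ (.fromPath (.mk γ)))⁻¹ *
        φ (.fromPath (.mk (p x₀))) := by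
  have h : FundamentalGroup.fromPath (.mk (((p x₀).trans γ).trans (p x₀).symm)) =
      (FundamentalGroup.fromPath (.mk (p x₀)))⁻¹ *
        (FundamentalGroup.fromPath (.mk γ) * FundamentalGroup.fromPath (.mk (p x₀))) := by
    rw [FundamentalGroup.mul_def, FundamentalGroup.mul_def, FundamentalGroup.inv_def]
    rfl
  change (φ _)⁻¹ = _
  rw [h, map_mul, map_mul, map_inv]
  group

end PathHom

variable {ι : Type*} {U : ι → Set X} {E : Type*} [Group E]

/-- Each `r i` trivializes `F` on `U i`. Along `γ`, the quantity `q (D t i) * r i (γ t) * (F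
(γ|[0,t]))⁻¹` is independent of the chart and locally constant; comparing its values at both ends
relates `q ∘ ψ` to `F`. -/
lemma exists_lift_pathHom (hU : ∀ i, IsOpen (U i)) (hcover : ∀ x, ∃ i, x ∈ U i) (F : PathHom X G)
    (r : ι → X → G)
    (hr : ∀ i x y (γ : Path x y), (∀ t, γ t ∈ U i) → r i x * F.toFun γ = r i y)
    (q : E →* G) (k : ι → ι → E)
    (hk : ∀ i j l, (U i ∩ U j ∩ U l).Nonempty → k i j * k j l = k i l)
    (hq : ∀ i j x, x ∈ U i → x ∈ U j → q (k i j) = r i x * (r j x)⁻¹) (x₀ : X) :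
    ∃ ψ : Path.Homotopic.Quotient x₀ x₀ → E, (∀ c c', ψ (c.trans c') = ψ c * ψ c') ∧
      ∃ a : G, ∀ γ : Path x₀ x₀, q (ψ (.mk γ)) = a * F.toFun γ * a⁻¹ := by
  obtain ⟨i₀, hi₀⟩ := hcover x₀
  obtain ⟨ψ, hψ, h⟩ := exists_monodromy hU hcover k hk hi₀
  refine ⟨ψ, hψ, r i₀ x₀, fun γ => ?_⟩
  obtain ⟨D, hindep, hloc, h0, h1⟩ := h γ
  have hconst := eq_of_locally_constant_on_cover hcover γ
    (fun t i => q (D t i) * r i (γ t) * (F.toFun (γ.subpath 0 t))⁻¹)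
    (fun t i j hi hj => by
      rw [hindep t i j hi hj, map_mul, hq i j _ hi hj]
      group)
    (fun t₀ i hi => by
      have hnear : ∀ᶠ t in 𝓝 t₀, ∀ s ∈ Set.uIcc t₀ t, γ s ∈ U i := by
        have h1 : Tendsto (fun t => Set.uIcc t₀ t) (𝓝 t₀) (𝓝 t₀).smallSets :=
          tendsto_const_nhds.uIcc tendsto_id
        exact h1.eventually (eventually_smallSets_forall.2
          (γ.continuous.continuousAt.eventually_mem ((hU i).mem_nhds hi)))
      filter_upwards [hnear, hloc t₀ i hi] with t ht hD
      refine ⟨hD.1, ?_⟩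
      rw [hD.2, F.map_subpath γ 0 t₀ t, ← hr i _ _ (γ.subpath t₀ t) fun s => ht _ ?_]
      · group
      · rw [← Path.range_subpathAux]
        exact ⟨s, rfl⟩)
    (t := 0) (t' := 1) (i := i₀) (i' := i₀) (by simpa using hi₀) (by simpa using hi₀)
  rw [Path.subpath_self, F.map_refl, Path.subpath_zero_one, F.map_cast, h0, h1, map_one, one_mul,
    γ.source, γ.target, inv_one, mul_one] at hconst
  rw [eq_comm, mul_inv_eq_iff_eq_mul]
  exact eq_mul_inv_iff_mul_eq.1 hconst

/-- A homomorphism from the fundamental group to `G` is encoded by a cocycle on a suitable open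
cover, and lifts of this cocycle along an epimorphism give lifts of the homomorphism. -/
theorem exists_cocycle_of_hom [PathConnectedSpace X] (hU : ∀ i, IsOpen (U i))
    (hcover : ∀ x, ∃ i, x ∈ U i) (hpath : ∀ i, IsPathConnected (U i))
    (hhom : ∀ i x y (γ γ' : Path x y), (∀ t, γ t ∈ U i) → (∀ t, γ' t ∈ U i) → γ.Homotopic γ')
    (hinter : ∀ i j, ∀ x ∈ U i ∩ U j, ∀ y ∈ U i ∩ U j, JoinedIn (U i ∩ U j) x y) {x₀ : X}
    (φ : FundamentalGroup X x₀ →* G) :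
    ∃ g : ι → ι → G, (∀ i j l, (U i ∩ U j ∩ U l).Nonempty → g i j * g j l = g i l) ∧
      ∀ (E : Type v) [Group E] (q : E →* G), Function.Surjective q → ∀ k : ι → ι → E,
        (∀ i j l, (U i ∩ U j ∩ U l).Nonempty → k i j * k j l = k i l) →
        (∀ i j, (U i ∩ U j).Nonempty → q (k i j) = g i j) →
        ∃ ψ : FundamentalGroup X x₀ →* E, ∀ c, q (ψ c) = φ c := by
  classical
  set F := PathHom.ofFundamentalGroup φ (PathConnectedSpace.somePath x₀) with hF
  choose u hu huU using hpath
  let r : ι → X → G := fun i x => if h : x ∈ U i then F.toFun (huU i h).somePath else 1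
  have hr (i : ι) (x y : X) (γ : Path x y) (hγ : ∀ t, γ t ∈ U i) :
      r i x * F.toFun γ = r i y := by
    have hx : x ∈ U i := by simpa using hγ 0
    have hy : y ∈ U i := by simpa using hγ 1
    simp only [r, dif_pos hx, dif_pos hy]
    rw [← F.map_trans]
    refine F.map_homotopic (hhom i _ _ _ _ (fun t => ?_) (huU i hy).somePath_mem)
    have : ((huU i hx).somePath.trans γ) t ∈ Set.range ((huU i hx).somePath.trans γ) := ⟨t, rfl⟩
    rw [Path.trans_range] at this
    obtain ⟨s, hs⟩ | ⟨s, hs⟩ := this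
    · exact hs ▸ (huU i hx).somePath_mem s
    · exact hs ▸ hγ s
  let g : ι → ι → G := fun i j =>
    if h : (U i ∩ U j).Nonempty then r i h.some * (r j h.some)⁻¹ else 1
  -- Independence of the point holds because the overlap is path connected: along a path in it both
  -- factors change by the same `F`-value.
  have hg (i j : ι) (x : X) (hi : x ∈ U i) (hj : x ∈ U j) : g i j = r i x * (r j x)⁻¹ := by
    have h : (U i ∩ U j).Nonempty := ⟨x, hi, hj⟩
    simp only [g, dif_pos h]
    have hJ := hinter i j _ h.some_mem x ⟨hi, hj⟩
    rw [← hr i _ x hJ.somePath fun t => (hJ.somePath_mem t).1,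
      ← hr j _ x hJ.somePath fun t => (hJ.somePath_mem t).2]
    group
  refine ⟨g, ?_, ?_⟩
  · rintro i j l ⟨x, ⟨hi, hj⟩, hl⟩
    rw [hg i j x hi hj, hg j l x hj hl, hg i l x hi hl]
    group
  · intro E _ q hsurj k hk hqk
    obtain ⟨ψ, hψ, a, ha⟩ := exists_lift_pathHom hU hcover F r hr q k hk
      (fun i j x hi hj => by rw [hqk i j ⟨x, hi, hj⟩, hg i j x hi hj]) x₀
    -- Conjugating by a lift `e` undoes both conjugations, the one by `a` and the one from the
    -- chosen loop at `x₀`.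
    obtain ⟨e, he⟩ := hsurj (a * (φ (.fromPath (.mk (PathConnectedSpace.somePath x₀ x₀))))⁻¹)
    refine ⟨MonoidHom.mk' (fun c => e⁻¹ * (ψ c)⁻¹ * e) fun c c' => ?_, fun c => ?_⟩
    · rw [FundamentalGroup.mul_def, hψ]
      group
    · induction c using Path.Homotopic.Quotient.ind with | mk γ => ?_
      rw [MonoidHom.mk'_apply, map_mul, map_mul, map_inv, map_inv, ha, he, hF,
        PathHom.ofFundamentalGroup_loop]
      change _ = φ (.fromPath (.mk γ))
      group

end Lifting

/-! ### Open stars in the realization of a simplicial complex -/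

section Realization

open unitInterval Topology

variable {n : ℕ} (K : AbstractSimplicialComplex (Fin n))

/-- The open star of the simplex with vertex set `A`, in the ambient space. -/
def openStarSet (A : Finset (Fin n)) : Set (Fin n → ℝ) := {x ∈ realization K | ∀ v ∈ A, x v ≠ 0}

/-- The barycenter of the simplex with vertex set `A`. -/
noncomputable def barycenter (A : Finset (Fin n)) : Fin n → ℝ :=
  fun v => if v ∈ A then (A.card : ℝ)⁻¹ else 0

variable {K}

lemma barycenter_mem_stdSimplex {A : Finset (Fin n)} (hA : A.Nonempty) :
    barycenter A ∈ stdSimplex ℝ (Fin n) := by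
  refine ⟨fun v => ?_, ?_⟩
  · unfold barycenter
    positivity
  · have : (A.card : ℝ) ≠ 0 := by exact_mod_cast hA.card_ne_zero
    simp [barycenter, this]

lemma barycenter_pos {A : Finset (Fin n)} {v : Fin n} (hv : v ∈ A) : 0 < barycenter A v := by
  have : 0 < (A.card : ℝ) := by exact_mod_cast Finset.card_pos.2 ⟨v, hv⟩
  simp only [barycenter, if_pos hv]
  positivity

lemma barycenter_mem_openStarSet {A : Finset (Fin n)} (hA : A ∈ K.faces) :
    barycenter A ∈ openStarSet K A :=
  ⟨⟨barycenter_mem_stdSimplex (K.isRelLowerSet_faces hA).1, A, hA, fun _ hv => if_neg hv⟩,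
    fun _ hv => (barycenter_pos hv).ne'⟩

/-- Any face carrying a point of the star contains `A`, so the segment to the barycenter stays in
that face, and its coordinates on `A` stay positive. -/
lemma starConvex_openStarSet {A : Finset (Fin n)} (hA : A.Nonempty) :
    StarConvex ℝ (barycenter A) (openStarSet K A) := by
  rintro x ⟨⟨hx, s, hs, hxs⟩, hxA⟩ a b ha hb hab
  refine ⟨⟨convex_stdSimplex ℝ (Fin n) (barycenter_mem_stdSimplex hA) hx ha hb hab, s, hs,
    fun i hi => ?_⟩, fun v hv => ?_⟩
  · have hiA : i ∉ A := fun h => hxA i h (hxs i hi)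
    simp [barycenter, hiA, hxs i hi]
  · have h1 := barycenter_pos hv
    have h2 : 0 < x v := (hx.1 v).lt_of_ne' (hxA v hv)
    refine ne_of_gt ?_
    change 0 < a * barycenter A v + b * x v
    obtain rfl | ha' := ha.eq_or_lt
    · obtain rfl : b = 1 := by linarith
      linarith
    · nlinarith [mul_pos ha' h1, mul_nonneg hb h2.le]

lemma mem_faces_of_mem_openStarSet {A : Finset (Fin n)} (hA : A.Nonempty) {x : Fin n → ℝ}
    (hx : x ∈ openStarSet K A) : A ∈ K.faces := by
  obtain ⟨⟨-, s, hs, hxs⟩, hxA⟩ := hx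
  refine (K.isRelLowerSet_faces hs).2 (fun v hv => ?_) hA
  by_contra h
  exact hxA v hv (hxs v h)

lemma contractibleSpace_openStarSet {A : Finset (Fin n)} (hA : A ∈ K.faces) :
    ContractibleSpace (openStarSet K A) :=
  (starConvex_openStarSet (K.isRelLowerSet_faces hA).1).contractibleSpace
    ⟨_, barycenter_mem_openStarSet hA⟩

variable (K) in
/-- The open star of the simplex with vertex set `A`. -/
def openStar (A : Finset (Fin n)) : Set (realization K) := {x | ∀ v ∈ A, x.1 v ≠ 0}

variable (K) in
/-- The open star as a subspace of the realization. -/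
def openStarInclusion (A : Finset (Fin n)) : C(openStarSet K A, realization K) where
  toFun x := ⟨x.1, x.2.1⟩
  continuous_toFun := by fun_prop

lemma isOpen_openStar (A : Finset (Fin n)) : IsOpen (openStar K A) := by
  have : openStar K A = ⋂ v ∈ A, {x : realization K | x.1 v ≠ 0} := by
    ext x
    simp [openStar]
  rw [this]
  refine isOpen_biInter_finset fun v _ => isOpen_ne_fun ?_ continuous_const
  exact (continuous_apply v).comp continuous_subtype_val

lemma exists_mem_openStar_singleton (x : realization K) : ∃ v, x ∈ openStar K {v} := by
  by_contra! h
  have h0 : ∀ v, x.1 v = 0 := fun v => by simpa [openStar] using h v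
  have h1 := x.2.1.2
  simp [h0] at h1

lemma joinedIn_openStar {A : Finset (Fin n)} (hA : A ∈ K.faces) {x y : realization K}
    (hx : x ∈ openStar K A) (hy : y ∈ openStar K A) : JoinedIn (openStar K A) x y := by
  have := contractibleSpace_openStarSet hA
  let γ := PathConnectedSpace.somePath (⟨x.1, x.2, hx⟩ : openStarSet K A) ⟨y.1, y.2, hy⟩
  exact ⟨γ.map (openStarInclusion K A).continuous, fun t => (γ t).2.2⟩

lemma homotopic_of_mem_openStar {A : Finset (Fin n)} (hA : A ∈ K.faces) {x y : realization K}
    (γ γ' : Path x y) (hγ : ∀ t, γ t ∈ openStar K A) (hγ' : ∀ t, γ' t ∈ openStar K A) :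
    γ.Homotopic γ' := by
  have := contractibleSpace_openStarSet hA
  have hx : x ∈ openStar K A := by simpa using hγ 0
  have hy : y ∈ openStar K A := by simpa using hγ 1
  let lift (δ : Path x y) (hδ : ∀ t, δ t ∈ openStar K A) :
      Path (⟨x.1, x.2, hx⟩ : openStarSet K A) ⟨y.1, y.2, hy⟩ :=
    { toFun := fun t => ⟨(δ t).1, (δ t).2, hδ t⟩
      continuous_toFun := by fun_prop
      source' := Subtype.ext (by simp)
      target' := Subtype.ext (by simp) }
  exact (SimplyConnectedSpace.paths_homotopic (lift γ hγ) (lift γ' hγ')).map (openStarInclusion K A)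

lemma isPathConnected_openStar {A : Finset (Fin n)} (hA : A ∈ K.faces) :
    IsPathConnected (openStar K A) := by
  have h := barycenter_mem_openStarSet hA
  have h' : (⟨_, h.1⟩ : realization K) ∈ openStar K A := h.2
  exact ⟨_, h', fun _ hy => joinedIn_openStar hA h' hy⟩

lemma inter_openStar (A B : Finset (Fin n)) : openStar K A ∩ openStar K B = openStar K (A ∪ B) := by
  ext x
  simp [openStar, or_imp, forall_and]

/-- Together with `inter_openStar`, this identifies the nerve of the cover by vertex stars with `K`.
-/
lemma nonempty_openStar_iff {A : Finset (Fin n)} (hA : A.Nonempty) :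
    (openStar K A).Nonempty ↔ A ∈ K.faces :=
  ⟨fun ⟨x, hx⟩ => mem_faces_of_mem_openStarSet hA ⟨x.2, hx⟩,
    fun h => (isPathConnected_openStar h).nonempty⟩

lemma singleton_mem_faces (a : Fin n) : {a} ∈ K.faces := K.singleton_mem a

/-- A retraction of the fundamental group of a complex onto `G` gives an edge cocycle with values in
`G` all of whose lifts split. -/
theorem exists_isEdgeCocycle_splitsLifts [PathConnectedSpace (realization K)] {x₀ : realization K}
    {G : Type u} [Group G] (φ : FundamentalGroup (realization K) x₀ →* G)
    (s : G →* FundamentalGroup (realization K) x₀) (hs : ∀ g, φ (s g) = g) :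
    ∃ g : Fin n → Fin n → G, IsEdgeCocycle K.faces g ∧ SplitsLifts K.faces g := by
  have h2 (a b : Fin n) : openStar K {a} ∩ openStar K {b} = openStar K {a, b} :=
    inter_openStar _ _
  have h3 (a b c : Fin n) :
      openStar K {a} ∩ openStar K {b} ∩ openStar K {c} = openStar K {a, b, c} := by
    rw [inter_openStar, inter_openStar, Finset.union_assoc]
    rfl
  have hiff (a b c : Fin n) :
      (openStar K {a} ∩ openStar K {b} ∩ openStar K {c}).Nonempty ↔ {a, b, c} ∈ K.faces := by
    rw [h3, nonempty_openStar_iff (Finset.insert_nonempty _ _)]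
  obtain ⟨g, hg, hlift⟩ := exists_cocycle_of_hom (U := fun v => openStar K {v})
    (fun v => isOpen_openStar _) exists_mem_openStar_singleton
    (fun v => isPathConnected_openStar (singleton_mem_faces v))
    (fun v _ _ => homotopic_of_mem_openStar (singleton_mem_faces v))
    (fun a b x hx y hy => by
      rw [h2] at hx hy ⊢
      exact joinedIn_openStar
        ((nonempty_openStar_iff (Finset.insert_nonempty _ _)).1 ⟨x, hx⟩) hx hy) φ
  refine ⟨g, fun a b c h => hg a b c ((hiff a b c).2 h), fun E _ q hq k hk hqk => ?_⟩
  obtain ⟨ψ, hψ⟩ := hlift E q hq k (fun a b c h => hk a b c ((hiff a b c).1 h)) (fun a b h => by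
    rw [h2, nonempty_openStar_iff (Finset.insert_nonempty _ _)] at h
    exact hqk a b h)
  exact ⟨ψ.comp s, fun x => by rw [MonoidHom.comp_apply, hψ, hs]⟩

end Realization

theorem theorem3 (G : Type u) (T : Type v) [Group G] [Group T]
    (hG : Group.IsFinitelyPresented G) (hT : Group.IsFinitelyPresented T)
    (hA : PropertyA G) (hχ : truncEuler G ≤ 2) (hH2 : Nontrivial (homologyF2 G 2)) :
    ((2 * rho (truncEuler G) - 2 * truncEuler G).toNat : ℕ∞) ≤
      simplicialComplexity (Monoid.Coprod G T) := by
  refine le_sInf ?_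
  rintro m ⟨n, K, -, ⟨_, x₀, ⟨e⟩⟩, rfl⟩
  -- The projection of the free product onto `G` is a retraction, with the inclusion of the factor
  -- as its section.
  obtain ⟨g, hg, hsplit⟩ := exists_isEdgeCocycle_splitsLifts
    (Monoid.Coprod.fst.comp e.toMonoidHom) (e.symm.toMonoidHom.comp Monoid.Coprod.inl)
    (fun x => by simp)
  have hfin : {s ∈ K.faces | s.card = 3}.Finite := Set.toFinite _
  have hmain := rho_le_card_triangles singleton_mem_faces hg hsplit (T := hfin.toFinset)
    (fun t => by simp) hA hH2
  rw [numTriangles, Set.ncard_eq_toFinset_card _ hfin]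
  exact_mod_cast Int.toNat_le.2 hmain
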